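/- Let $(X_{ij})_{i,j=1}^\infty$ be an array of i.i.d. real random variables such that $E e^{c|X_{ij}|}<\infty$ for some $c>0$, $E X_{ij}=0$, $E X_{ij}^2=1$ and $\gamma:=E X_{ij}^3\neq 0$. For each $n\ge 1$ let $d=d_n\geq 3$ be an integer, and suppose that $$\frac{\log^3 d}{n}\to 0\quad\text{and}\quad \frac{d\log^3 d}{n}\to\infty\qquad (n\to\infty).$$ Let $X_i=(X_{i1},\dots,X_{id})^\top$ and $W=n^{-1/2}\sum_{i=1}^n X_i\in\mathbb{R}^d$, and let $Z\sim N(0,I_d)$ be a standard Gaussian vector in $\mathbb{R}^d$. Then $$\limsup_{n\to\infty}\sqrt{\frac{n}{\log^3 d}}\;\sup_{x\in\mathbb{R}}\left|P\Big(\max_{1\le j\le d}W_j\le x\Big)-P\Big(\max_{1\le j\le d}Z_j\le x\Big)\right|>0.$$ -/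

import Mathlib

open Filter Topology MeasureTheory ProbabilityTheory

/-- The vector `W = n^{-1/2} ∑_{i=1}^n X_i ∈ ℝ^d`, where `X_i = (X_{i1}, …, X_{id})` are the
truncated rows of the infinite array `X` (indices start at `0` here). -/
noncomputable def normalizedSum {Ω : Type*} (X : ℕ → ℕ → Ω → ℝ) (n d : ℕ) (ω : Ω) :
    EuclideanSpace ℝ (Fin d) :=
  WithLp.toLp 2 fun j => (√(n : ℝ))⁻¹ * ∑ i ∈ Finset.range n, X i j ω

/-- The largest coordinate of a vector of `ℝ^d` (a maximum of finitely many reals; only used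
for `d ≥ 1`). -/
noncomputable def maxCoord {d : ℕ} (w : EuclideanSpace ℝ (Fin d)) : ℝ :=
  ⨆ j : Fin d, w j

/-- The Kolmogorov distance `sup_x |P(U ≤ x) - P(V ≤ x)|` between two real random variables,
possibly defined on different probability spaces. -/
noncomputable def kolmogorovDist {Ω Ω' : Type*} [MeasurableSpace Ω] [MeasurableSpace Ω']
    (P : Measure Ω) (P' : Measure Ω') (U : Ω → ℝ) (V : Ω' → ℝ) : ℝ :=
  ⨆ x : ℝ, |P.real {ω | U ω ≤ x} - P'.real {ω | V ω ≤ x}|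

/-- The function `u ↦ u₊ e^{-u₊}`. -/
noncomputable def ramp (u : ℝ) : ℝ := max u 0 * Real.exp (-max u 0)

lemma ramp_of_nonneg {u : ℝ} (hu : 0 ≤ u) : ramp u = u * Real.exp (-u) := by
  simp [ramp, hu]

lemma ramp_of_nonpos {u : ℝ} (hu : u ≤ 0) : ramp u = 0 := by
  simp [ramp, hu]

lemma integrableOn_mul_exp_neg :
    IntegrableOn (fun u : ℝ => u * Real.exp (-u)) (Set.Ioi 0) := by
  have h := Real.GammaIntegral_convergent (s := 2) (by norm_num)
  refine h.congr_fun (fun x _ => ?_) measurableSet_Ioi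
  norm_num
  ring

/-- The kernel `(2 + i s)⁻²`, the Fourier transform of `u ↦ u₊ e^{-2u₊}`. -/
noncomputable def rampKernel (s : ℝ) : ℂ := ((2 + Complex.I * s) ^ 2)⁻¹

lemma two_add_I_mul_ne_zero (s : ℝ) : (2 + Complex.I * s : ℂ) ≠ 0 := by
  intro h
  have := congrArg Complex.re h
  simp at this

lemma continuous_rampKernel : Continuous rampKernel := by
  unfold rampKernel
  exact Continuous.inv₀ (by fun_prop) fun s => pow_ne_zero 2 (two_add_I_mul_ne_zero s)

lemma norm_two_add_I_mul_sq (s : ℝ) : ‖(2 + Complex.I * s : ℂ)‖ ^ 2 = 4 + s ^ 2 := by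
  rw [← Complex.normSq_eq_norm_sq, Complex.normSq_apply]
  simp
  ring

lemma norm_rampKernel (s : ℝ) : ‖rampKernel s‖ = (4 + s ^ 2)⁻¹ := by
  rw [rampKernel, norm_inv, norm_pow, norm_two_add_I_mul_sq]

lemma integrable_rampKernel : Integrable rampKernel := by
  refine integrable_inv_one_add_sq.mono' continuous_rampKernel.aestronglyMeasurable
    (ae_of_all _ fun s => ?_)
  rw [norm_rampKernel]
  gcongr
  norm_num

lemma integral_mul_cexp_neg_mul_Ioi {b : ℂ} (hb : 1 ≤ b.re) :
    ∫ u : ℝ in Set.Ioi 0, (u : ℂ) * Complex.exp (-b * u) = (b ^ 2)⁻¹ := by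
  have hb0 : b ≠ 0 := fun h => by simp [h] at hb; linarith
  have hnorm : ∀ u : ℝ, 0 ≤ u → ‖Complex.exp (-b * u)‖ ≤ Real.exp (-u) := by
    intro u hu
    rw [Complex.norm_exp]
    apply Real.exp_le_exp.mpr
    simp
    nlinarith
  have hderiv : ∀ u ∈ Set.Ioi (0 : ℝ), HasDerivAt
      (fun u : ℝ => -((u : ℂ) / b + (b ^ 2)⁻¹) * Complex.exp (-b * u))
      ((u : ℂ) * Complex.exp (-b * u)) u := by
    intro u _
    have h1 : HasDerivAt (fun u : ℝ => (u : ℂ)) 1 u := Complex.ofRealCLM.hasDerivAt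
    have h2 := ((h1.div_const b).add_const (b ^ 2)⁻¹).neg
    have h3 := (h1.const_mul (-b)).cexp
    convert! h2.mul h3 using 1
    simp only [Pi.neg_apply]
    field_simp
    ring
  have hint : IntegrableOn (fun u : ℝ => (u : ℂ) * Complex.exp (-b * u)) (Set.Ioi 0) := by
    refine Integrable.mono' integrableOn_mul_exp_neg (by fun_prop) ?_
    refine (ae_restrict_iff' measurableSet_Ioi).mpr (ae_of_all _ fun u hu => ?_)
    have hu' : (0 : ℝ) < u := hu
    rw [norm_mul, Complex.norm_real, Real.norm_of_nonneg hu'.le]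
    exact mul_le_mul_of_nonneg_left (hnorm u hu'.le) hu'.le
  have hlim : Tendsto (fun u : ℝ => -((u : ℂ) / b + (b ^ 2)⁻¹) * Complex.exp (-b * u))
      atTop (𝓝 0) := by
    have e1 : Tendsto (fun u : ℝ => u * Real.exp (-u)) atTop (𝓝 0) := by
      simpa using Real.tendsto_pow_mul_exp_neg_atTop_nhds_zero 1
    have e2 : Tendsto (fun u : ℝ => Real.exp (-u)) atTop (𝓝 0) :=
      Real.tendsto_exp_neg_atTop_nhds_zero
    have e3 : Tendsto (fun u : ℝ => ‖b‖⁻¹ * (u * Real.exp (-u)) + ‖(b ^ 2)⁻¹‖ * Real.exp (-u))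
        atTop (𝓝 0) := by
      simpa only [mul_zero, add_zero] using
        (e1.const_mul ‖b‖⁻¹).add (e2.const_mul ‖(b ^ 2)⁻¹‖)
    refine squeeze_zero_norm' ?_ e3
    filter_upwards [eventually_ge_atTop 0] with u hu
    rw [norm_mul, norm_neg]
    calc ‖(u : ℂ) / b + (b ^ 2)⁻¹‖ * ‖Complex.exp (-b * u)‖
        ≤ (u * ‖b‖⁻¹ + ‖(b ^ 2)⁻¹‖) * Real.exp (-u) := by
          gcongr
          · refine (norm_add_le _ _).trans ?_
            rw [norm_div, Complex.norm_real, Real.norm_of_nonneg hu, div_eq_mul_inv]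
          · exact hnorm u hu
      _ = _ := by ring
  rw [integral_Ioi_of_hasDerivAt_of_tendsto (by fun_prop) hderiv hint hlim]
  simp

open FourierTransform in
lemma fourier_mul_exp_neg_two_mul (w : ℝ) :
    𝓕 (fun u : ℝ => ((max u 0 * Real.exp (-2 * max u 0) : ℝ) : ℂ)) w
      = rampKernel (2 * Real.pi * w) := by
  rw [Real.fourier_real_eq_integral_exp_smul,
    ← setIntegral_eq_integral_of_forall_compl_eq_zero (s := Set.Ioi 0)]
  · have := integral_mul_cexp_neg_mul_Ioi (b := 2 + Complex.I * (2 * Real.pi * w : ℝ)) (by simp)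
    rw [rampKernel, ← this]
    refine setIntegral_congr_fun measurableSet_Ioi fun u hu => ?_
    have hu' : (0 : ℝ) < u := hu
    simp only [max_eq_left hu'.le, smul_eq_mul]
    push_cast
    rw [mul_left_comm, ← Complex.exp_add]
    congr 2
    ring
  · intro u hu
    have hu' : u ≤ 0 := not_lt.mp hu
    simp [hu']

open FourierTransform in
lemma ofReal_ramp_eq_integral (u : ℝ) :
    ((ramp u : ℝ) : ℂ) = (2 * Real.pi : ℂ)⁻¹ *
      ∫ s : ℝ, rampKernel s * Complex.exp ((1 + Complex.I * s) * u) := by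
  set G : ℝ → ℂ := fun u : ℝ => ((max u 0 * Real.exp (-2 * max u 0) : ℝ) : ℂ) with hG
  have hGc : Continuous G := by rw [hG]; fun_prop
  have hGi : Integrable G := by
    have : IntegrableOn G (Set.Ioi 0) := by
      refine Integrable.mono' integrableOn_mul_exp_neg hGc.aestronglyMeasurable ?_
      refine (ae_restrict_iff' measurableSet_Ioi).mpr (ae_of_all _ fun u hu => ?_)
      have hu' : (0 : ℝ) < u := hu
      rw [hG]
      simp only [Complex.norm_real, max_eq_left hu'.le]
      rw [Real.norm_of_nonneg (by positivity)]
      gcongr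
      linarith
    rw [← integrableOn_iff_integrable_of_support_subset (s := Set.Ioi 0)]
    · exact this
    · intro u hu
      by_contra h
      have hu' : u ≤ 0 := not_lt.mp h
      simp [hG, hu'] at hu
  have hF : 𝓕 G = fun w => rampKernel (2 * Real.pi * w) := funext fourier_mul_exp_neg_two_mul
  have hFi : Integrable (𝓕 G) := by
    rw [hF]
    exact integrable_rampKernel.comp_mul_left' (by positivity)
  have hinv := congrFun (hGc.fourierInv_fourier_eq hGi hFi) u
  rw [Real.fourierInv_eq', hF] at hinv
  have hsub := Measure.integral_comp_mul_left
    (fun s : ℝ => Complex.exp (Complex.I * s * u) * rampKernel s) (2 * Real.pi)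
  have hl : (∫ v : ℝ, Complex.exp (↑(2 * Real.pi * inner ℝ v u) * Complex.I) •
      rampKernel (2 * Real.pi * v)) =
      ∫ v : ℝ, Complex.exp (Complex.I * (2 * Real.pi * v : ℝ) * u) * rampKernel (2 * Real.pi * v) := by
    congr 1
    ext v
    rw [smul_eq_mul]
    congr 2
    simp
    ring
  rw [hl, hsub] at hinv
  have hramp : ((ramp u : ℝ) : ℂ) = Complex.exp u * G u := by
    rcases le_total 0 u with h | h
    · rw [ramp_of_nonneg h, hG]
      simp only [max_eq_left h]
      rw [← Complex.ofReal_exp, ← Complex.ofReal_mul, mul_left_comm, ← Real.exp_add]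
      congr 3
      ring
    · simp [ramp_of_nonpos h, hG, h]
  have hpi : |(2 * Real.pi)⁻¹| = (2 * Real.pi)⁻¹ := abs_of_pos (by positivity)
  rw [hramp, ← hinv, hpi, Complex.real_smul]
  push_cast
  rw [mul_left_comm, ← integral_const_mul]
  congr 2
  ext s
  rw [← mul_assoc, ← Complex.exp_add, mul_comm]
  congr 2
  ring

lemma integral_ramp_eq_integral_complexMGF (μ : Measure ℝ) [IsProbabilityMeasure μ] {h : ℝ}
    (hh : 0 < h) (hint : Integrable (fun x => Real.exp (h * x)) μ) :
    Integrable (fun t : ℝ => rampKernel (t / h) * (Complex.exp (-(h + Complex.I * t) * h) *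
      complexMGF id μ (h + Complex.I * t))) ∧
    ((∫ w, ramp (h * (w - h)) ∂μ : ℝ) : ℂ) = (2 * Real.pi * h : ℂ)⁻¹ *
      ∫ t : ℝ, rampKernel (t / h) * (Complex.exp (-(h + Complex.I * t) * h) *
        complexMGF id μ (h + Complex.I * t)) := by
  set f : ℝ → ℝ → ℂ := fun w s =>
    rampKernel s * Complex.exp ((1 + Complex.I * s) * (h * (w - h) : ℝ)) with hf
  have hfi : Integrable (Function.uncurry f) (μ.prod volume) := by
    have h1 : Integrable (fun w => Real.exp (h * (w - h))) μ := by
      have := hint.mul_const (Real.exp (-(h * h)))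
      refine this.congr (ae_of_all _ fun w => ?_)
      simp only
      rw [← Real.exp_add]
      congr 1
      ring
    have h2 := h1.mul_prod integrable_rampKernel.norm
    refine h2.mono' ?_ (ae_of_all _ fun p => ?_)
    · refine Continuous.aestronglyMeasurable ?_
      have := continuous_rampKernel
      rw [hf]
      simp only [Function.uncurry_def]
      fun_prop
    · change ‖rampKernel p.2 * Complex.exp ((1 + Complex.I * p.2) * (h * (p.1 - h) : ℝ))‖ ≤ _
      rw [norm_mul, mul_comm, Complex.norm_exp]
      simp
  have hinner : ∀ s : ℝ, ∫ w, f w s ∂μ = rampKernel s *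
      (Complex.exp (-(h + Complex.I * (s * h : ℝ)) * h) *
        complexMGF id μ (h + Complex.I * (s * h : ℝ))) := by
    intro s
    rw [hf]
    simp only
    rw [integral_const_mul, complexMGF]
    congr 1
    rw [← integral_const_mul]
    congr 1
    ext w
    rw [← Complex.exp_add]
    congr 1
    push_cast
    simp only [id]
    ring
  have hright := hfi.integral_prod_right
  simp only [Function.uncurry_apply_pair, hinner] at hright
  have hcongr : ∀ t : ℝ, t / h * h = t := fun t => div_mul_cancel₀ t hh.ne'
  constructor
  · have := hright.comp_div hh.ne'
    simpa only [hcongr] using this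
  · have hsub := Measure.integral_comp_div (fun s : ℝ => rampKernel s *
      (Complex.exp (-(h + Complex.I * (s * h : ℝ)) * h) *
        complexMGF id μ (h + Complex.I * (s * h : ℝ)))) h
    simp only [hcongr] at hsub
    rw [hsub, ← integral_complex_ofReal]
    simp_rw [ofReal_ramp_eq_integral]
    rw [integral_const_mul, integral_integral_swap hfi]
    simp_rw [hinner]
    rw [abs_of_pos hh, Complex.real_smul, ← mul_assoc]
    congr 1
    have : (h : ℂ) ≠ 0 := by exact_mod_cast hh.ne'
    field_simp

lemma integrableOn_one_sub_mul_exp_neg :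
    IntegrableOn (fun u : ℝ => (1 - u) * Real.exp (-u)) (Set.Ioi 0) := by
  have := (integrableOn_exp_neg_Ioi 0).sub integrableOn_mul_exp_neg
  refine this.congr (ae_of_all _ fun u => ?_)
  simp only [Pi.sub_apply]
  ring

lemma ramp_eq_setIntegral (y : ℝ) :
    ramp y = ∫ u in Set.Ioi (0 : ℝ), (1 - u) * Real.exp (-u) * (Set.Iio y).indicator 1 u := by
  have h1 : ∫ u in Set.Ioi (0 : ℝ), (1 - u) * Real.exp (-u) * (Set.Iio y).indicator 1 u =
      ∫ u in Set.Ioo 0 y, (1 - u) * Real.exp (-u) := by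
    rw [← integral_indicator measurableSet_Ioi, ← integral_indicator measurableSet_Ioo]
    congr 1
    ext u
    by_cases h1 : 0 < u <;> by_cases h2 : u < y <;> simp [Set.indicator, h1, h2]
  rw [h1]
  rcases le_total y 0 with hy | hy
  · rw [ramp_of_nonpos hy, Set.Ioo_eq_empty (by simpa using hy)]
    simp
  · rw [← integral_Ioc_eq_integral_Ioo, ← intervalIntegral.integral_of_le hy, ramp_of_nonneg hy,
      intervalIntegral.integral_eq_sub_of_hasDerivAt (f := fun u => u * Real.exp (-u))]
    · simp
    · intro u _
      have h2 := (hasDerivAt_id u).mul ((hasDerivAt_id u).neg.exp)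
      convert! h2 using 1
      simp
      ring
    · exact Continuous.intervalIntegrable (by fun_prop) _ _

lemma integral_ramp_eq_setIntegral_tail (μ : Measure ℝ) [IsProbabilityMeasure μ] {h : ℝ}
    (hh : 0 < h) :
    ∫ w, ramp (h * (w - h)) ∂μ =
      ∫ u in Set.Ioi (0 : ℝ), (1 - u) * Real.exp (-u) * μ.real (Set.Ioi (h + u / h)) := by
  simp_rw [ramp_eq_setIntegral]
  rw [integral_integral_swap]
  · refine setIntegral_congr_fun measurableSet_Ioi fun u _ => ?_
    rw [integral_const_mul]
    congr 1
    rw [← integral_indicator_one measurableSet_Ioi]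
    congr 1
    ext w
    have : u < h * (w - h) ↔ h + u / h < w := by
      rw [← lt_sub_iff_add_lt', div_lt_iff₀' hh]
    simp [Set.indicator, this]
  · have h2 := (integrable_const (μ := μ) (1 : ℝ)).mul_prod integrableOn_one_sub_mul_exp_neg
    refine h2.mono ?_ (ae_of_all _ fun p => ?_)
    · refine Measurable.aestronglyMeasurable ?_
      have hset : MeasurableSet {p : ℝ × ℝ | p.2 < h * (p.1 - h)} :=
        measurableSet_lt (by fun_prop) (by fun_prop)
      have h3 : Measurable ({p : ℝ × ℝ | p.2 < h * (p.1 - h)}.indicator (1 : ℝ × ℝ → ℝ)) :=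
        measurable_one.indicator hset
      have h4 : Measurable fun p : ℝ × ℝ => (1 - p.2) * Real.exp (-p.2) := by fun_prop
      exact h4.mul h3
    · simp only [Function.uncurry_def, norm_mul, one_mul]
      refine mul_le_of_le_one_right (by positivity) ?_
      rw [Set.indicator_apply]
      split_ifs <;> simp

lemma setIntegral_abs_one_sub_mul_exp_neg_le :
    ∫ u in Set.Ioi (0 : ℝ), |(1 - u) * Real.exp (-u)| ≤ 2 := by
  have h1 : ∫ u in Set.Ioi (0 : ℝ), u * Real.exp (-u) = 1 := by
    have := Real.Gamma_eq_integral (s := 2) (by norm_num)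
    rw [Real.Gamma_two] at this
    rw [this]
    refine setIntegral_congr_fun measurableSet_Ioi fun u _ => ?_
    norm_num
    ring
  have h2 : ∫ u in Set.Ioi (0 : ℝ), Real.exp (-u) = 1 := by
    simpa using integral_exp_neg_Ioi 0
  have h3 : (2 : ℝ) = ∫ u in Set.Ioi (0 : ℝ), (Real.exp (-u) + u * Real.exp (-u)) := by
    rw [integral_add (integrableOn_exp_neg_Ioi 0) integrableOn_mul_exp_neg, h1, h2]
    norm_num
  rw [h3]
  refine setIntegral_mono_on integrableOn_one_sub_mul_exp_neg.abs
    ((integrableOn_exp_neg_Ioi 0).add integrableOn_mul_exp_neg) measurableSet_Ioi fun u hu => ?_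
  have hu' : (0 : ℝ) < u := hu
  rw [abs_mul, abs_of_pos (Real.exp_pos _), ← one_add_mul]
  gcongr
  rw [abs_le]
  constructor <;> linarith

lemma abs_integral_ramp_sub_le (μ ν : Measure ℝ) [IsProbabilityMeasure μ] [IsProbabilityMeasure ν]
    {h ε : ℝ} (hh : 0 < h)
    (hle : ∀ x, h ≤ x → |μ.real (Set.Ioi x) - ν.real (Set.Ioi x)| ≤ ε) :
    |∫ w, ramp (h * (w - h)) ∂μ - ∫ w, ramp (h * (w - h)) ∂ν| ≤ 2 * ε := by
  have hε : 0 ≤ ε := (abs_nonneg _).trans (hle h le_rfl)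
  have hint : ∀ (ρ : Measure ℝ) [IsProbabilityMeasure ρ], IntegrableOn
      (fun u : ℝ => (1 - u) * Real.exp (-u) * ρ.real (Set.Ioi (h + u / h))) (Set.Ioi 0) := by
    intro ρ _
    have hanti : Antitone fun u : ℝ => ρ.real (Set.Ioi (h + u / h)) := by
      intro a b hab
      refine measureReal_mono (Set.Ioi_subset_Ioi ?_)
      gcongr
    refine Integrable.mul_bdd (c := 1) integrableOn_one_sub_mul_exp_neg
      hanti.measurable.aestronglyMeasurable (ae_of_all _ fun u => ?_)
    rw [Real.norm_of_nonneg measureReal_nonneg]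
    exact measureReal_le_one
  rw [integral_ramp_eq_setIntegral_tail μ hh, integral_ramp_eq_setIntegral_tail ν hh,
    ← integral_sub (hint μ) (hint ν)]
  calc |∫ u in Set.Ioi (0 : ℝ), ((1 - u) * Real.exp (-u) * μ.real (Set.Ioi (h + u / h)) -
          (1 - u) * Real.exp (-u) * ν.real (Set.Ioi (h + u / h)))|
      ≤ ∫ u in Set.Ioi (0 : ℝ), |(1 - u) * Real.exp (-u)| * ε := by
        rw [← Real.norm_eq_abs]
        refine norm_integral_le_of_norm_le (integrableOn_one_sub_mul_exp_neg.abs.mul_const ε)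
          ((ae_restrict_iff' measurableSet_Ioi).mpr (ae_of_all _ fun u hu => ?_))
        have hu' : (0 : ℝ) < u := hu
        rw [← mul_sub, norm_mul, Real.norm_eq_abs, Real.norm_eq_abs]
        gcongr
        refine hle _ ?_
        have : 0 < u / h := by positivity
        linarith
    _ = (∫ u in Set.Ioi (0 : ℝ), |(1 - u) * Real.exp (-u)|) * ε := integral_mul_const _ _
    _ ≤ 2 * ε := by
        gcongr
        exact setIntegral_abs_one_sub_mul_exp_neg_le

/-- The classical Gaussian tail bound `P(Z > h) ≤ e^{-h²/2} / (h √(2π))`. -/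
lemma gaussianReal_Ioi_le {h : ℝ} (hh : 0 < h) :
    (gaussianReal 0 1).real (Set.Ioi h) ≤ (h * Real.exp (h ^ 2 / 2) * √(2 * Real.pi))⁻¹ := by
  have hpdf : ∀ x, gaussianPDFReal 0 1 x = (√(2 * Real.pi))⁻¹ * Real.exp (-x ^ 2 / 2) := by
    intro x
    simp [gaussianPDFReal]
  have hderiv : ∀ x ∈ Set.Ioi h, HasDerivAt
      (fun x : ℝ => -((√(2 * Real.pi))⁻¹ * Real.exp (-x ^ 2 / 2) / h))
      (x / h * gaussianPDFReal 0 1 x) x := by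
    intro x _
    have h1 : HasDerivAt (fun x : ℝ => -x ^ 2 / 2) (-x) x := by
      have := ((hasDerivAt_pow 2 x).neg).div_const 2
      convert! this using 1
      simp
      ring
    have h2 := (((h1.exp).const_mul (√(2 * Real.pi))⁻¹).div_const h).neg
    convert! h2 using 1
    rw [hpdf]
    ring
  have hlim : Tendsto (fun x : ℝ => -((√(2 * Real.pi))⁻¹ * Real.exp (-x ^ 2 / 2) / h))
      atTop (𝓝 0) := by
    have h1 : Tendsto (fun x : ℝ => x ^ 2 / 2) atTop atTop :=
      (tendsto_pow_atTop (by norm_num)).atTop_div_const (by norm_num)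
    have h2 := Real.tendsto_exp_neg_atTop_nhds_zero.comp h1
    have h3 := ((h2.const_mul (√(2 * Real.pi))⁻¹).div_const h).neg
    simpa [Function.comp_def, neg_div] using h3
  have hnn : ∀ x ∈ Set.Ioi h, 0 ≤ x / h * gaussianPDFReal 0 1 x := fun x hx =>
    mul_nonneg (div_nonneg (hh.le.trans (le_of_lt hx)) hh.le) (gaussianPDFReal_nonneg _ _ _)
  have hcont : ContinuousWithinAt
      (fun x : ℝ => -((√(2 * Real.pi))⁻¹ * Real.exp (-x ^ 2 / 2) / h)) (Set.Ici h) h := by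
    fun_prop
  have hint := integrableOn_Ioi_deriv_of_nonneg hcont hderiv hnn hlim
  have hval := integral_Ioi_of_hasDerivAt_of_nonneg hcont hderiv hnn hlim
  have hmeas : (gaussianReal 0 1).real (Set.Ioi h) = ∫ x in Set.Ioi h, gaussianPDFReal 0 1 x := by
    rw [measureReal_def, gaussianReal_apply_eq_integral _ one_ne_zero, ENNReal.toReal_ofReal]
    exact integral_nonneg fun x => gaussianPDFReal_nonneg _ _ _
  rw [hmeas]
  refine (setIntegral_mono_on (integrable_gaussianPDFReal 0 1).integrableOn hint
    measurableSet_Ioi fun x hx => ?_).trans (hval.le.trans_eq ?_)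
  · refine le_mul_of_one_le_left (gaussianPDFReal_nonneg _ _ _) ?_
    rw [one_le_div hh]
    exact le_of_lt hx
  · rw [neg_div, Real.exp_neg]
    field_simp
    ring

lemma norm_one_add_pow_sub_le (y : ℂ) (n : ℕ) :
    ‖(1 + y) ^ n - 1 - n * y‖ ≤ (n * ‖y‖) ^ 2 * Real.exp (n * ‖y‖) := by
  induction n with
  | zero => simp
  | succ n ih =>
    have hb := norm_nonneg y
    have e : (1 + y) ^ (n + 1) - 1 - ((n + 1 : ℕ) : ℂ) * y =
        ((1 + y) ^ n - 1 - n * y) * (1 + y) + n * y ^ 2 := by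
      push_cast
      ring
    have h1 : ‖1 + y‖ ≤ Real.exp ‖y‖ := by
      have := norm_add_le 1 y
      rw [norm_one] at this
      linarith [Real.add_one_le_exp ‖y‖]
    have h2 : 1 ≤ Real.exp ((n + 1) * ‖y‖) := Real.one_le_exp (by positivity)
    rw [e]
    calc ‖((1 + y) ^ n - 1 - n * y) * (1 + y) + n * y ^ 2‖
        ≤ ‖(1 + y) ^ n - 1 - n * y‖ * ‖1 + y‖ + n * ‖y‖ ^ 2 := by
          refine (norm_add_le _ _).trans ?_
          rw [norm_mul, norm_mul, norm_pow, Complex.norm_natCast]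
      _ ≤ (n * ‖y‖) ^ 2 * Real.exp (n * ‖y‖) * Real.exp ‖y‖ +
          n * ‖y‖ ^ 2 * Real.exp ((n + 1) * ‖y‖) := by
          refine add_le_add (by gcongr) ?_
          exact le_mul_of_one_le_right (by positivity) h2
      _ = (n ^ 2 + n) * ‖y‖ ^ 2 * Real.exp ((n + 1) * ‖y‖) := by
          rw [mul_assoc, ← Real.exp_add]
          ring_nf
      _ ≤ (n + 1) ^ 2 * ‖y‖ ^ 2 * Real.exp ((n + 1) * ‖y‖) := by
          gcongr
          nlinarith
      _ = _ := by push_cast; ring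

lemma integrable_exp_mul_of_integrable_exp_mul_abs {μ : Measure ℝ} {c b : ℝ}
    (hc : Integrable (fun x => Real.exp (c * |x|)) μ) (hb : |b| ≤ c) :
    Integrable (fun x => Real.exp (b * x)) μ := by
  refine hc.mono' (by fun_prop) (ae_of_all _ fun x => ?_)
  rw [Real.norm_of_nonneg (Real.exp_pos _).le]
  apply Real.exp_le_exp.mpr
  calc b * x ≤ |b * x| := le_abs_self _
    _ = |b| * |x| := abs_mul _ _
    _ ≤ c * |x| := by gcongr

lemma exists_norm_complexMGF_sub_le (μ : Measure ℝ) [IsProbabilityMeasure μ] {c : ℝ} (hc : 0 < c)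
    (hexp : Integrable (fun x => Real.exp (c * |x|)) μ)
    (hmean : ∫ x, x ∂μ = 0) (hvar : ∫ x, x ^ 2 ∂μ = 1) :
    ∃ K : ℝ, 0 ≤ K ∧ ∀ z : ℂ, ‖z‖ ≤ c / 2 →
      ‖complexMGF id μ z - (1 + z ^ 2 / 2 + (∫ x, x ^ 3 ∂μ : ℝ) * z ^ 3 / 6)‖ ≤ K * ‖z‖ ^ 4 := by
  have hp := integrable_exp_mul_of_integrable_exp_mul_abs hexp (abs_of_pos hc).le
  have hm := integrable_exp_mul_of_integrable_exp_mul_abs hexp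
    (b := -c) (by rw [abs_neg, abs_of_pos hc])
  have hmom : ∀ k : ℕ, Integrable (fun x : ℝ => x ^ k) μ := fun k =>
    integrable_pow_of_integrable_exp_mul (X := id) hc.ne' hp hm k
  have hdom : Integrable (fun x : ℝ => |x| ^ 4 * Real.exp (c / 2 * |x|)) μ := by
    have := integrable_pow_abs_mul_exp_add_of_integrable_exp_mul (X := id) (v := 0) (t := c)
      (x := c / 2) (μ := μ) (by simpa using hp) (by simpa using hm) (by positivity)
      (by rw [abs_of_pos hc]; linarith) 4
    simpa using this
  refine ⟨∫ x, |x| ^ 4 * Real.exp (c / 2 * |x|) ∂μ, integral_nonneg fun x => by positivity,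
    fun z hz => ?_⟩
  have hcexp : Integrable (fun x : ℝ => Complex.exp (z * x)) μ := by
    refine integrable_cexp_mul_of_re_mem_integrableExpSet (X := fun x : ℝ => x) (by fun_prop) ?_
    exact integrable_exp_mul_of_integrable_exp_mul_abs hexp
      ((Complex.abs_re_le_norm z).trans (by linarith))
  have hpow : ∀ k : ℕ, Integrable (fun x : ℝ => (x : ℂ) ^ k) μ := fun k => by
    simpa using (hmom k).ofReal (𝕜 := ℂ)
  have hint : ∀ k : ℕ, ∫ x : ℝ, (x : ℂ) ^ k ∂μ = (∫ x, x ^ k ∂μ : ℝ) := fun k => by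
    rw [← integral_complex_ofReal]
    simp
  have e : complexMGF id μ z - (1 + z ^ 2 / 2 + (∫ x, x ^ 3 ∂μ : ℝ) * z ^ 3 / 6) =
      ∫ x : ℝ, (Complex.exp (z * x) -
        ∑ m ∈ Finset.range 4, (z * x) ^ m / (m.factorial : ℂ)) ∂μ := by
    have hterm : ∀ m ∈ Finset.range 4,
        Integrable (fun x : ℝ => (z * x) ^ m / (m.factorial : ℂ)) μ := fun m _ => by
      simp_rw [mul_pow]
      exact ((hpow m).const_mul _).div_const _
    rw [integral_sub hcexp (integrable_finsetSum _ hterm), integral_finsetSum _ hterm]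
    simp_rw [mul_pow, integral_div, integral_const_mul, hint]
    have h1 : ∫ x, x ^ 1 ∂μ = 0 := by simpa using hmean
    simp [Finset.sum_range_succ, complexMGF, hmean, hvar, Nat.factorial]
    ring
  rw [e, mul_comm, ← integral_const_mul]
  refine norm_integral_le_of_norm_le (hdom.const_mul _) (ae_of_all _ fun x => ?_)
  refine (Complex.norm_exp_sub_sum_le_norm_mul_exp _ 4).trans ?_
  rw [norm_mul, Complex.norm_real, Real.norm_eq_abs, mul_pow, mul_assoc]
  gcongr

/-- The moment generating function of `μ` divided by that of a standard Gaussian. -/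
noncomputable def mgfRatio (μ : Measure ℝ) (z : ℂ) : ℂ :=
  complexMGF id μ z * Complex.exp (-(z ^ 2 / 2))

lemma exists_norm_mgfRatio_sub_le (μ : Measure ℝ) [IsProbabilityMeasure μ] {c : ℝ} (hc : 0 < c)
    (hexp : Integrable (fun x => Real.exp (c * |x|)) μ)
    (hmean : ∫ x, x ∂μ = 0) (hvar : ∫ x, x ^ 2 ∂μ = 1) :
    ∃ r C : ℝ, 0 < r ∧ r ≤ c ∧ 0 < C ∧ ∀ z : ℂ, ‖z‖ ≤ r →
      ‖mgfRatio μ z - 1 - (∫ x, x ^ 3 ∂μ : ℝ) * z ^ 3 / 6‖ ≤ C * ‖z‖ ^ 4 ∧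
      ‖mgfRatio μ z - 1‖ ≤ C * ‖z‖ ^ 3 := by
  obtain ⟨K, hK, hM⟩ := exists_norm_complexMGF_sub_le μ hc hexp hmean hvar
  set γ := ∫ x, x ^ 3 ∂μ
  set C := K * Real.exp 1 + (2 + |γ|) + 1 + |γ| with hC
  have hC0 : 0 < C := by positivity
  refine ⟨min (c / 2) 1, C + |γ|, by positivity, (min_le_left _ _).trans (by linarith),
    by positivity, fun z hz => ?_⟩
  have hz1 : ‖z‖ ≤ 1 := hz.trans (min_le_right _ _)
  have hz0 := norm_nonneg z
  set T : ℂ := 1 + z ^ 2 / 2 + γ * z ^ 3 / 6 with hT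
  have hT' : ‖T‖ ≤ 2 + |γ| := by
    have h2 : ‖z‖ ^ 2 ≤ 1 := pow_le_one₀ hz0 hz1
    have h3 : ‖z‖ ^ 3 ≤ 1 := pow_le_one₀ hz0 hz1
    have h4 : |γ| * ‖z‖ ^ 3 ≤ |γ| := mul_le_of_le_one_right (abs_nonneg _) h3
    calc ‖T‖ ≤ ‖(1 : ℂ)‖ + ‖z ^ 2 / 2‖ + ‖γ * z ^ 3 / 6‖ := norm_add₃_le
      _ = 1 + ‖z‖ ^ 2 / 2 + |γ| * ‖z‖ ^ 3 / 6 := by simp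
      _ ≤ 2 + |γ| := by linarith [abs_nonneg γ]
  have hq : ‖-(z ^ 2 / 2)‖ ≤ 1 := by
    rw [norm_neg, norm_div, norm_pow, Complex.norm_ofNat]
    have : ‖z‖ ^ 2 ≤ 1 := pow_le_one₀ hz0 hz1
    linarith
  have hE : ‖Complex.exp (-(z ^ 2 / 2))‖ ≤ Real.exp 1 :=
    (Complex.norm_exp_le_exp_norm _).trans (Real.exp_le_exp.mpr hq)
  have hE2 : ‖Complex.exp (-(z ^ 2 / 2)) - 1 - -(z ^ 2 / 2)‖ ≤ ‖z‖ ^ 4 := by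
    refine (Complex.norm_exp_sub_one_sub_id_le hq).trans ?_
    rw [norm_neg, norm_div, norm_pow, Complex.norm_ofNat]
    have : 0 ≤ ‖z‖ ^ 4 := by positivity
    nlinarith
  have e : mgfRatio μ z - 1 - γ * z ^ 3 / 6 =
      (complexMGF id μ z - T) * Complex.exp (-(z ^ 2 / 2)) +
      T * (Complex.exp (-(z ^ 2 / 2)) - 1 - -(z ^ 2 / 2)) +
      (-(1 / 4) * z ^ 4 - γ / 12 * z ^ 5) := by
    rw [mgfRatio, hT]
    ring
  have h1 : ‖mgfRatio μ z - 1 - γ * z ^ 3 / 6‖ ≤ C * ‖z‖ ^ 4 := by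
    rw [e]
    have h5 : ‖z‖ ^ 5 ≤ ‖z‖ ^ 4 := pow_le_pow_of_le_one hz0 hz1 (by norm_num)
    calc _ ≤ ‖complexMGF id μ z - T‖ * ‖Complex.exp (-(z ^ 2 / 2))‖ +
          ‖T‖ * ‖Complex.exp (-(z ^ 2 / 2)) - 1 - -(z ^ 2 / 2)‖ +
          (1 / 4 * ‖z‖ ^ 4 + |γ| / 12 * ‖z‖ ^ 5) := by
          refine norm_add₃_le.trans ?_
          rw [norm_mul, norm_mul]
          gcongr
          refine (norm_sub_le _ _).trans (le_of_eq ?_)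
          simp
      _ ≤ K * ‖z‖ ^ 4 * Real.exp 1 + (2 + |γ|) * ‖z‖ ^ 4 +
          (1 * ‖z‖ ^ 4 + |γ| * ‖z‖ ^ 4) := by
          have hg := abs_nonneg γ
          have hM' := hM z (hz.trans (min_le_left _ _))
          gcongr
          · norm_num
          · linarith
      _ = C * ‖z‖ ^ 4 := by rw [hC]; ring
  have h43 : ‖z‖ ^ 4 ≤ ‖z‖ ^ 3 := pow_le_pow_of_le_one hz0 hz1 (by norm_num)
  constructor
  · refine h1.trans ?_
    gcongr
    linarith [abs_nonneg γ]
  · have e2 : mgfRatio μ z - 1 = (mgfRatio μ z - 1 - γ * z ^ 3 / 6) + γ * z ^ 3 / 6 := by ring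
    rw [e2]
    calc _ ≤ C * ‖z‖ ^ 4 + |γ| * ‖z‖ ^ 3 / 6 := by
          refine (norm_add_le _ _).trans (add_le_add h1 (le_of_eq ?_))
          simp
      _ ≤ C * ‖z‖ ^ 3 + |γ| * ‖z‖ ^ 3 := by
          gcongr
          have : 0 ≤ |γ| * ‖z‖ ^ 3 := by positivity
          linarith
      _ = _ := by ring

lemma norm_ofReal_add_I_mul_le {h : ℝ} (hh : 1 ≤ h) (t : ℝ) :
    ‖(h + Complex.I * t : ℂ)‖ ≤ h * (1 + |t|) := by
  refine (norm_add_le _ _).trans ?_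
  rw [norm_mul, Complex.norm_I, Complex.norm_real, Complex.norm_real, Real.norm_eq_abs,
    Real.norm_eq_abs, abs_of_pos (by linarith)]
  nlinarith [abs_nonneg t]

lemma norm_ofReal_add_I_mul_pow_three_le {h : ℝ} (hh : 0 ≤ h) (t : ℝ) :
    ‖(h + Complex.I * t : ℂ)‖ ^ 3 ≤ 4 * (h ^ 3 + |t| ^ 3) := by
  have h1 : ‖(h + Complex.I * t : ℂ)‖ ≤ h + |t| := by
    refine (norm_add_le _ _).trans ?_
    rw [norm_mul, Complex.norm_I, Complex.norm_real, Complex.norm_real, Real.norm_eq_abs,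
      Real.norm_eq_abs, abs_of_nonneg hh, one_mul]
  refine (pow_le_pow_left₀ (norm_nonneg _) h1 3).trans ?_
  have := add_pow_le hh (abs_nonneg t) 3
  norm_num at this
  exact this

lemma norm_pow_sub_le_of_taylor {γ C h t : ℝ} {n : ℕ} {R : ℂ} (hC : 0 < C) (hn : 1 ≤ n)
    (hh : 1 ≤ h) (hh3 : 4 * C * h ^ 3 ≤ √n) (ht : 16 * C * |t| ≤ √n)
    (hR1 : ‖R - 1 - γ * ((h + Complex.I * t) / √n) ^ 3 / 6‖
      ≤ C * ‖((h + Complex.I * t) / √n : ℂ)‖ ^ 4)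
    (hR2 : ‖R - 1‖ ≤ C * ‖((h + Complex.I * t) / √n : ℂ)‖ ^ 3) :
    ‖R ^ n - 1 - γ * (h + Complex.I * t) ^ 3 / (6 * √n)‖ ≤
      (3 * C ^ 2 + C) * (h ^ 6 / n) * (1 + |t|) ^ 6 * Real.exp (t ^ 2 / 4) := by
  set ζ : ℂ := h + Complex.I * t with hζ
  have hv : 0 < √(n : ℝ) := Real.sqrt_pos.mpr (by exact_mod_cast hn)
  have hv2 : √(n : ℝ) ^ 2 = n := Real.sq_sqrt (by positivity)
  set v := √(n : ℝ) with hv_def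
  have hnC : (n : ℂ) = (v : ℂ) ^ 2 := by exact_mod_cast hv2.symm
  have hvC : (v : ℂ) ≠ 0 := by exact_mod_cast hv.ne'
  have hz : ‖ζ / (v : ℂ)‖ = ‖ζ‖ / v := by
    rw [norm_div, Complex.norm_real, Real.norm_of_nonneg hv.le]
  rw [hz] at hR1 hR2
  have hρ0 := norm_nonneg ζ
  have hρq : ‖ζ‖ ≤ h * (1 + |t|) := norm_ofReal_add_I_mul_le hh t
  have hρ3 : ‖ζ‖ ^ 3 ≤ 4 * (h ^ 3 + |t| ^ 3) :=
    norm_ofReal_add_I_mul_pow_three_le (by linarith) t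
  have hq1 : 1 ≤ h * (1 + |t|) := by nlinarith [abs_nonneg t]
  set a := (n : ℝ) * ‖R - 1‖ with ha
  have ha1 : a ≤ C * ‖ζ‖ ^ 3 / v := by
    calc a ≤ n * (C * (‖ζ‖ / v) ^ 3) := by rw [ha]; gcongr
      _ = C * ‖ζ‖ ^ 3 / v := by rw [← hv2]; field_simp
  have ha2 : a ≤ 1 + t ^ 2 / 4 := by
    refine ha1.trans ?_
    rw [div_le_iff₀ hv]
    have e : |t| ^ 3 = |t| * t ^ 2 := by rw [← sq_abs t]; ring
    have := mul_le_mul_of_nonneg_right ht (sq_nonneg t)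
    calc C * ‖ζ‖ ^ 3 ≤ C * (4 * (h ^ 3 + |t| ^ 3)) := by gcongr
      _ ≤ _ := by rw [e]; linarith
  have ha0 : 0 ≤ a := by positivity
  have hb := norm_one_add_pow_sub_le (R - 1) n
  rw [add_sub_cancel, ← ha] at hb
  have e : R ^ n - 1 - γ * ζ ^ 3 / (6 * v) = (R ^ n - 1 - n * (R - 1)) +
      n * (R - 1 - γ * (ζ / v) ^ 3 / 6) := by
    rw [hnC]
    field_simp
    ring
  have hexp : Real.exp a ≤ 3 * Real.exp (t ^ 2 / 4) := by
    refine (Real.exp_le_exp.mpr ha2).trans ?_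
    rw [Real.exp_add]
    gcongr
    linarith [Real.exp_one_lt_d9]
  have hexp1 : 1 ≤ Real.exp (t ^ 2 / 4) := Real.one_le_exp (by positivity)
  rw [e]
  have hn0 : (0 : ℝ) < n := by exact_mod_cast hn
  calc _ ≤ a ^ 2 * Real.exp a + n * (C * (‖ζ‖ / v) ^ 4) := by
        refine (norm_add_le _ _).trans (add_le_add hb ?_)
        rw [norm_mul, Complex.norm_natCast]
        gcongr
    _ ≤ (C * ‖ζ‖ ^ 3 / v) ^ 2 * (3 * Real.exp (t ^ 2 / 4)) + C * ‖ζ‖ ^ 4 / n := by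
        gcongr
        rw [← hv2]
        apply le_of_eq
        field_simp
    _ = 3 * C ^ 2 * ‖ζ‖ ^ 6 / n * Real.exp (t ^ 2 / 4) + C * ‖ζ‖ ^ 4 / n * 1 := by
        rw [← hv2]
        field_simp
    _ ≤ 3 * C ^ 2 * (h * (1 + |t|)) ^ 6 / n * Real.exp (t ^ 2 / 4) +
        C * (h * (1 + |t|)) ^ 6 / n * Real.exp (t ^ 2 / 4) := by
        gcongr
        exact (pow_le_pow_left₀ hρ0 hρq 4).trans (pow_le_pow_right₀ hq1 (by norm_num))
    _ = _ := by ring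

lemma norm_rampKernel_sub_le (s : ℝ) : ‖rampKernel s - 1 / 4‖ ≤ |s| := by
  have hne := two_add_I_mul_ne_zero s
  have e : rampKernel s - 1 / 4 = -(Complex.I * s) * (2 + (2 + Complex.I * s)) /
      (4 * (2 + Complex.I * s) ^ 2) := by
    rw [rampKernel]
    field_simp
    ring
  have h2 : 2 ≤ ‖(2 + Complex.I * s : ℂ)‖ := by
    have := norm_two_add_I_mul_sq s
    nlinarith [norm_nonneg (2 + Complex.I * s : ℂ), sq_nonneg s]
  rw [e, norm_div, norm_mul, norm_neg, norm_mul, Complex.norm_I, Complex.norm_real,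
    Real.norm_eq_abs, norm_mul, norm_pow, Complex.norm_ofNat, div_le_iff₀ (by positivity), one_mul]
  have h3 : ‖(2 + (2 + Complex.I * s) : ℂ)‖ ≤ 4 * ‖(2 + Complex.I * s : ℂ)‖ ^ 2 := by
    refine (norm_add_le _ _).trans ?_
    rw [Complex.norm_ofNat]
    nlinarith
  gcongr

lemma norm_kernel_mul_cube_sub_le {h : ℝ} (hh : 1 ≤ h) (t : ℝ) :
    ‖rampKernel (t / h) * (h + Complex.I * t) ^ 3 - h ^ 3 / 4‖ ≤ 2 * h ^ 2 * (1 + |t|) ^ 6 := by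
  have hh0 : 0 < h := by linarith
  set ζ : ℂ := h + Complex.I * t with hζ
  have hρq : ‖ζ‖ ≤ h * (1 + |t|) := norm_ofReal_add_I_mul_le hh t
  have ht := abs_nonneg t
  have hhq : h ≤ h * (1 + |t|) := by nlinarith
  have hk : ‖rampKernel (t / h) - 1 / 4‖ ≤ |t| / h := by
    refine (norm_rampKernel_sub_le _).trans_eq ?_
    rw [abs_div, abs_of_pos hh0]
  have e : rampKernel (t / h) * ζ ^ 3 - h ^ 3 / 4 = (rampKernel (t / h) - 1 / 4) * ζ ^ 3 +
      1 / 4 * ((Complex.I * t) * (ζ ^ 2 + ζ * h + h ^ 2)) := by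
    rw [hζ]
    ring
  rw [e]
  have h1 : ‖ζ ^ 2 + ζ * h + (h : ℂ) ^ 2‖ ≤ 3 * (h * (1 + |t|)) ^ 2 := by
    refine norm_add₃_le.trans ?_
    rw [norm_pow, norm_mul, norm_pow, Complex.norm_real, Real.norm_of_nonneg hh0.le]
    calc ‖ζ‖ ^ 2 + ‖ζ‖ * h + h ^ 2 ≤ (h * (1 + |t|)) ^ 2 + (h * (1 + |t|)) * (h * (1 + |t|)) +
          (h * (1 + |t|)) ^ 2 := by gcongr
      _ = _ := by ring
  have hq : 1 ≤ 1 + |t| := by linarith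
  calc _ ≤ |t| / h * (h * (1 + |t|)) ^ 3 + 1 / 4 * (|t| * (3 * (h * (1 + |t|)) ^ 2)) := by
        refine (norm_add_le _ _).trans ?_
        rw [norm_mul, norm_mul, norm_mul, norm_mul, Complex.norm_I, norm_pow, Complex.norm_real,
          Real.norm_eq_abs, one_mul, show ‖(1 / 4 : ℂ)‖ = 1 / 4 by norm_num]
        gcongr
    _ = h ^ 2 * (|t| * (1 + |t|) ^ 3 + 3 / 4 * (|t| * (1 + |t|) ^ 2)) := by
        field_simp
    _ ≤ h ^ 2 * ((1 + |t|) * (1 + |t|) ^ 5 + 1 * ((1 + |t|) * (1 + |t|) ^ 5)) := by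
        have a1 : |t| ≤ 1 + |t| := by linarith
        have a2 : (1 + |t|) ^ 3 ≤ (1 + |t|) ^ 5 := pow_le_pow_right₀ hq (by norm_num)
        have a3 : (1 + |t|) ^ 2 ≤ (1 + |t|) ^ 5 := pow_le_pow_right₀ hq (by norm_num)
        gcongr
        norm_num
    _ = _ := by ring

/-- The integrand in the Fourier representation of the rescaled difference between the two
expectations of the ramp function. -/
noncomputable def ratioIntegrand (μ : Measure ℝ) (n : ℕ) (h t : ℝ) : ℂ :=
  Complex.exp (-(t ^ 2 / 2 : ℝ)) *
    (rampKernel (t / h) * (mgfRatio μ ((h + Complex.I * t) / √n) ^ n - 1))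

lemma norm_ratioIntegrand_sub_le_of_near {μ : Measure ℝ} {γ C h t : ℝ} {n : ℕ} (hC : 0 < C)
    (hn : 1 ≤ n) (hh : 1 ≤ h) (hh3 : 4 * C * h ^ 3 ≤ √n) (ht : 16 * C * |t| ≤ √n)
    (hR1 : ‖mgfRatio μ ((h + Complex.I * t) / √n) - 1 - γ * ((h + Complex.I * t) / √n) ^ 3 / 6‖
      ≤ C * ‖((h + Complex.I * t) / √n : ℂ)‖ ^ 4)
    (hR2 : ‖mgfRatio μ ((h + Complex.I * t) / √n) - 1‖
      ≤ C * ‖((h + Complex.I * t) / √n : ℂ)‖ ^ 3) :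
    ‖ratioIntegrand μ n h t - Complex.exp (-(t ^ 2 / 2 : ℝ)) * (γ * h ^ 3 / (24 * √n) : ℝ)‖ ≤
      (3 * C ^ 2 + C + |γ|) * (h ^ 2 / √n + h ^ 6 / n) *
        ((1 + |t|) ^ 6 * Real.exp (-(t ^ 2 / 4))) := by
  have hmain := norm_pow_sub_le_of_taylor hC hn hh hh3 ht hR1 hR2
  have hk := norm_kernel_mul_cube_sub_le hh t
  set R := mgfRatio μ ((h + Complex.I * t) / √n)
  set ζ : ℂ := h + Complex.I * t with hζ
  have hv : 0 < √(n : ℝ) := Real.sqrt_pos.mpr (by exact_mod_cast hn)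
  set v := √(n : ℝ) with hv_def
  have hvC : (v : ℂ) ≠ 0 := by exact_mod_cast hv.ne'
  have e : ratioIntegrand μ n h t - Complex.exp (-(t ^ 2 / 2 : ℝ)) * (γ * h ^ 3 / (24 * v) : ℝ) =
      Complex.exp (-(t ^ 2 / 2 : ℝ)) * (rampKernel (t / h) * (R ^ n - 1 - γ * ζ ^ 3 / (6 * v)) +
        γ / (6 * v) * (rampKernel (t / h) * ζ ^ 3 - h ^ 3 / 4)) := by
    rw [show ratioIntegrand μ n h t = Complex.exp (-(t ^ 2 / 2 : ℝ)) *
      (rampKernel (t / h) * (R ^ n - 1)) from rfl]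
    push_cast
    field_simp
    ring
  have hk1 : ‖rampKernel (t / h)‖ ≤ 1 := by
    rw [norm_rampKernel]
    exact inv_le_one_of_one_le₀ (by nlinarith [sq_nonneg (t / h)])
  have hexp : ‖Complex.exp (-(t ^ 2 / 2 : ℝ))‖ = Real.exp (-(t ^ 2 / 2)) := by
    rw [← Complex.ofReal_neg, Complex.norm_exp_ofReal]
  have hE1 : Real.exp (-(t ^ 2 / 2)) * Real.exp (t ^ 2 / 4) = Real.exp (-(t ^ 2 / 4)) := by
    rw [← Real.exp_add]
    congr 1
    ring
  have hE2 : Real.exp (-(t ^ 2 / 2)) ≤ Real.exp (-(t ^ 2 / 4)) :=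
    Real.exp_le_exp.mpr (by nlinarith [sq_nonneg t])
  have hnγ : ‖(γ / (6 * v) : ℂ)‖ = |γ| / (6 * v) := by
    rw [norm_div, norm_mul, Complex.norm_real, Complex.norm_real, Complex.norm_ofNat,
      Real.norm_eq_abs, Real.norm_of_nonneg hv.le]
  have hn0 : (0 : ℝ) < n := by exact_mod_cast hn
  rw [e, norm_mul, hexp]
  calc _ ≤ Real.exp (-(t ^ 2 / 2)) * (1 * ((3 * C ^ 2 + C) * (h ^ 6 / n) * (1 + |t|) ^ 6 *
          Real.exp (t ^ 2 / 4)) + |γ| / (6 * v) * (2 * h ^ 2 * (1 + |t|) ^ 6)) := by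
        gcongr
        refine (norm_add_le _ _).trans ?_
        rw [norm_mul, norm_mul, hnγ]
        gcongr
    _ = (3 * C ^ 2 + C) * (h ^ 6 / n) * (1 + |t|) ^ 6 *
          (Real.exp (-(t ^ 2 / 2)) * Real.exp (t ^ 2 / 4)) +
          |γ| * (h ^ 2 / v) * (1 + |t|) ^ 6 * (1 / 3 * Real.exp (-(t ^ 2 / 2))) := by
        field_simp
        ring
    _ ≤ (3 * C ^ 2 + C) * (h ^ 6 / n) * (1 + |t|) ^ 6 * Real.exp (-(t ^ 2 / 4)) +
          |γ| * (h ^ 2 / v) * (1 + |t|) ^ 6 * Real.exp (-(t ^ 2 / 4)) := by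
        rw [hE1]
        gcongr
        linarith [Real.exp_pos (-(t ^ 2 / 2))]
    _ ≤ (3 * C ^ 2 + C + |γ|) * (h ^ 2 / v + h ^ 6 / n) * (1 + |t|) ^ 6 *
          Real.exp (-(t ^ 2 / 4)) := by
        rw [← add_mul, ← add_mul]
        gcongr
        have a1 : 0 ≤ |γ| * (h ^ 6 / n) := by positivity
        have a2 : 0 ≤ (3 * C ^ 2 + C) * (h ^ 2 / v) := by positivity
        linarith
    _ = _ := by ring

lemma norm_ratioIntegrand_sub_le_of_far {μ : Measure ℝ} {γ C δ h t : ℝ} {n : ℕ} (hC : 0 < C)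
    (hδ : 0 < δ) (hn : 1 ≤ n) (hh : 1 ≤ h) (hh3 : h ^ 3 ≤ √n) (hh4 : 4 * C * h ^ 3 ≤ √n)
    (ht : δ * √n < |t|)
    (hR : ‖mgfRatio μ ((h : ℂ) / √n) - 1‖ ≤ C * ‖(h / √n : ℂ)‖ ^ 3) :
    ‖ratioIntegrand μ n h t - Complex.exp (-(t ^ 2 / 2 : ℝ)) * (γ * h ^ 3 / (24 * √n) : ℝ)‖ ≤
      (4 + |γ|) * (h ^ 2 * (2 / (δ ^ 2 * n))) * (1 + (t / (δ * √n)) ^ 2)⁻¹ := by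
  have hv : 0 < √(n : ℝ) := Real.sqrt_pos.mpr (by exact_mod_cast hn)
  have hv2 : √(n : ℝ) ^ 2 = n := Real.sq_sqrt (by positivity)
  set v := √(n : ℝ) with hv_def
  have hh0 : 0 < h := by linarith
  have ht0 : 0 < |t| := lt_of_le_of_lt (by positivity) ht
  have ht2 : 0 < t ^ 2 := by rw [← sq_abs]; positivity
  have hvC : (v : ℂ) ≠ 0 := by exact_mod_cast hv.ne'
  have hnC : (n : ℂ) = (v : ℂ) ^ 2 := by exact_mod_cast hv2.symm
  have hexp : ‖Complex.exp (-(t ^ 2 / 2 : ℝ))‖ = Real.exp (-(t ^ 2 / 2)) := by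
    rw [← Complex.ofReal_neg, Complex.norm_exp_ofReal]
  have hk : ‖rampKernel (t / h)‖ ≤ h ^ 2 / t ^ 2 := by
    rw [norm_rampKernel, div_pow, inv_le_comm₀ (by positivity) (by positivity), inv_div]
    linarith
  have hE : Real.exp (-(t ^ 2 / 2)) ≤ 2 / t ^ 2 := by
    rw [Real.exp_neg, inv_le_comm₀ (Real.exp_pos _) (by positivity), inv_div]
    linarith [Real.add_one_le_exp (t ^ 2 / 2)]
  have hE1 : Real.exp (-(t ^ 2 / 2)) ≤ 1 := Real.exp_le_one_iff.mpr (by linarith)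
  have hRpow : ‖mgfRatio μ ((h : ℂ) / v)‖ ^ n ≤ 3 := by
    have h1 : ‖(h / v : ℂ)‖ = h / v := by
      rw [norm_div, Complex.norm_real, Complex.norm_real, Real.norm_of_nonneg hh0.le,
        Real.norm_of_nonneg hv.le]
    rw [h1] at hR
    have h2 : ‖mgfRatio μ ((h : ℂ) / v)‖ ≤ Real.exp (C * (h / v) ^ 3) := by
      have := norm_add_le (mgfRatio μ ((h : ℂ) / v) - 1) 1
      rw [sub_add_cancel, norm_one] at this
      linarith [Real.add_one_le_exp (C * (h / v) ^ 3)]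
    calc _ ≤ Real.exp (C * (h / v) ^ 3) ^ n := pow_le_pow_left₀ (norm_nonneg _) h2 n
      _ = Real.exp (n * (C * (h / v) ^ 3)) := by rw [← Real.exp_nat_mul]
      _ ≤ Real.exp 1 := by
          apply Real.exp_le_exp.mpr
          have : (n : ℝ) * (C * (h / v) ^ 3) = C * h ^ 3 / v := by
            rw [← hv2]; field_simp
          rw [this, div_le_one hv]
          have : 0 ≤ C * h ^ 3 := by positivity
          linarith
      _ ≤ 3 := by linarith [Real.exp_one_lt_d9]
  have hcomp : ‖Complex.exp (-(t ^ 2 / 2 : ℝ))‖ * ‖mgfRatio μ ((h + Complex.I * t) / v)‖ ^ n ≤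
      ‖mgfRatio μ ((h : ℂ) / v)‖ ^ n := by
    have hz : ((h + Complex.I * t) / v : ℂ).re = h / v := by
      rw [show ((h + Complex.I * t) / v : ℂ) = (h / v : ℝ) + (t / v : ℝ) * Complex.I by
        push_cast; ring]
      simp
    have h1 : ‖mgfRatio μ ((h + Complex.I * t) / v)‖ ≤
        ‖mgfRatio μ ((h : ℂ) / v)‖ * Real.exp (t ^ 2 / (2 * n)) := by
      have hm : ‖complexMGF id μ ((h + Complex.I * t) / v)‖ ≤ ‖complexMGF id μ ((h : ℂ) / v)‖ := by
        refine norm_complexMGF_le_mgf.trans ?_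
        rw [hz, ← Complex.ofReal_div, complexMGF_ofReal, Complex.norm_real]
        exact le_abs_self _
      rw [mgfRatio, mgfRatio, norm_mul, norm_mul, mul_assoc]
      refine mul_le_mul hm (le_of_eq ?_) (norm_nonneg _) (norm_nonneg _)
      rw [Complex.norm_exp, Complex.norm_exp, ← Real.exp_add]
      congr 1
      rw [show -(((h + Complex.I * t) / v : ℂ) ^ 2 / 2) =
        (-((h / v) ^ 2 / 2) + t ^ 2 / (2 * n) : ℝ) + (-(h * t / v ^ 2) : ℝ) * Complex.I by
          push_cast
          rw [hnC]
          field_simp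
          ring_nf
          rw [Complex.I_sq]
          ring,
        show -((h / v : ℂ) ^ 2 / 2) = (-((h / v) ^ 2 / 2) : ℝ) by push_cast; rfl,
        Complex.add_re, Complex.re_ofReal_mul, Complex.ofReal_re, Complex.ofReal_re, Complex.I_re]
      ring
    calc _ ≤ Real.exp (-(t ^ 2 / 2)) *
          (‖mgfRatio μ ((h : ℂ) / v)‖ * Real.exp (t ^ 2 / (2 * n))) ^ n := by
          rw [hexp]
          gcongr
      _ = ‖mgfRatio μ ((h : ℂ) / v)‖ ^ n *
          (Real.exp (-(t ^ 2 / 2)) * Real.exp (n * (t ^ 2 / (2 * n)))) := by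
          rw [mul_pow, ← Real.exp_nat_mul]
          ring
      _ = _ := by
          have hn0 : (n : ℝ) ≠ 0 := by positivity
          rw [← Real.exp_add, show -(t ^ 2 / 2) + n * (t ^ 2 / (2 * n)) = 0 by field_simp; ring,
            Real.exp_zero, mul_one]
  have hsplit : (1 : ℝ) / t ^ 2 ≤ 2 / (δ ^ 2 * n) * (1 + (t / (δ * v)) ^ 2)⁻¹ := by
    have h1 : (δ * v) ^ 2 ≤ t ^ 2 := by
      rw [← sq_abs t]
      exact pow_le_pow_left₀ (by positivity) ht.le 2
    have h2 : 2 / (δ ^ 2 * n) * (1 + (t / (δ * v)) ^ 2)⁻¹ = 2 / ((δ * v) ^ 2 + t ^ 2) := by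
      rw [← hv2]
      field_simp
    rw [h2, div_le_div_iff₀ ht2 (by positivity)]
    linarith
  have hmainterm : ‖((γ * h ^ 3 / (24 * v) : ℝ) : ℂ)‖ ≤ |γ| / 24 := by
    rw [Complex.norm_real, Real.norm_eq_abs, abs_div, abs_mul, abs_of_pos (by positivity : 0 < h ^ 3),
      abs_of_pos (by positivity : 0 < 24 * v), div_le_div_iff₀ (by positivity) (by norm_num)]
    have : |γ| * h ^ 3 ≤ |γ| * v := by gcongr
    linarith
  have hh2 : 1 ≤ h ^ 2 := one_le_pow₀ hh
  calc _ ≤ ‖rampKernel (t / h)‖ * (‖Complex.exp (-(t ^ 2 / 2 : ℝ))‖ *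
          ‖mgfRatio μ ((h + Complex.I * t) / v)‖ ^ n) +
          ‖Complex.exp (-(t ^ 2 / 2 : ℝ))‖ * ‖rampKernel (t / h)‖ +
          ‖Complex.exp (-(t ^ 2 / 2 : ℝ))‖ * ‖((γ * h ^ 3 / (24 * v) : ℝ) : ℂ)‖ := by
        refine (norm_sub_le _ _).trans ?_
        rw [norm_mul _ ((γ * h ^ 3 / (24 * v) : ℝ) : ℂ)]
        gcongr
        rw [ratioIntegrand, norm_mul, norm_mul]
        calc _ ≤ ‖Complex.exp (-(t ^ 2 / 2 : ℝ))‖ * (‖rampKernel (t / h)‖ *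
              (‖mgfRatio μ ((h + Complex.I * t) / v)‖ ^ n + 1)) := by
              gcongr
              refine (norm_sub_le _ _).trans ?_
              rw [norm_pow, norm_one]
          _ = _ := by ring
    _ ≤ h ^ 2 / t ^ 2 * 3 + 1 * (h ^ 2 / t ^ 2) + 2 / t ^ 2 * (|γ| / 24) := by
        have := hcomp.trans hRpow
        rw [hexp] at this ⊢
        gcongr
    _ ≤ h ^ 2 / t ^ 2 * 3 + 1 * (h ^ 2 / t ^ 2) + h ^ 2 / t ^ 2 * |γ| := by
        refine add_le_add le_rfl ?_
        have : (1 / 12 : ℝ) / t ^ 2 ≤ h ^ 2 / t ^ 2 := by gcongr; linarith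
        calc 2 / t ^ 2 * (|γ| / 24) = (1 / 12) / t ^ 2 * |γ| := by ring
          _ ≤ _ := by gcongr
    _ = (4 + |γ|) * (h ^ 2 * (1 / t ^ 2)) := by ring
    _ ≤ (4 + |γ|) * (h ^ 2 * (2 / (δ ^ 2 * n) * (1 + (t / (δ * v)) ^ 2)⁻¹)) := by gcongr
    _ = _ := by ring

lemma integrable_one_add_abs_pow_mul_exp :
    Integrable fun t : ℝ => (1 + |t|) ^ 6 * Real.exp (-(t ^ 2 / 4)) := by
  have h1 : Integrable fun t : ℝ => 720 * Real.exp 3 * Real.exp (-(1 / 8) * t ^ 2) :=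
    (integrable_exp_neg_mul_sq (by norm_num)).const_mul _
  refine h1.mono' (by fun_prop) (ae_of_all _ fun t => ?_)
  rw [Real.norm_of_nonneg (by positivity)]
  have h2 := Real.pow_div_factorial_le_exp (1 + |t|) (by positivity) 6
  rw [div_le_iff₀ (by positivity)] at h2
  have h3 : ((Nat.factorial 6 : ℕ) : ℝ) = 720 := by norm_num [Nat.factorial]
  rw [h3] at h2
  calc _ ≤ Real.exp (1 + |t|) * 720 * Real.exp (-(t ^ 2 / 4)) := by gcongr
    _ = 720 * Real.exp (1 + |t| - t ^ 2 / 4) := by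
        rw [sub_eq_add_neg, Real.exp_add (1 + |t|)]; ring
    _ ≤ 720 * Real.exp (3 + -(1 / 8) * t ^ 2) := by
        gcongr
        nlinarith [sq_nonneg (|t| - 4), sq_abs t]
    _ = _ := by rw [Real.exp_add]; ring

lemma integral_cexp_neg_sq_div_two :
    ∫ t : ℝ, Complex.exp (-(t ^ 2 / 2 : ℝ)) = (√(2 * Real.pi) : ℝ) := by
  have h1 := integral_gaussian (1 / 2)
  rw [show Real.pi / (1 / 2) = 2 * Real.pi by ring] at h1
  rw [← h1, ← integral_complex_ofReal]
  congr 1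
  ext t
  rw [← Complex.ofReal_neg, Complex.ofReal_exp]
  congr 2
  ring

lemma integrable_cexp_neg_sq_div_two :
    Integrable fun t : ℝ => Complex.exp (-(t ^ 2 / 2 : ℝ)) := by
  have h1 := (integrable_exp_neg_mul_sq (b := 1 / 2) (by norm_num)).ofReal (𝕜 := ℂ)
  refine h1.congr (ae_of_all _ fun t => ?_)
  simp only
  rw [← Complex.ofReal_neg, ← Complex.ofReal_exp]
  congr 2
  ring

lemma exists_norm_integral_ratioIntegrand_sub_le (μ : Measure ℝ) [IsProbabilityMeasure μ] {c : ℝ}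
    (hc : 0 < c) (hexp : Integrable (fun x => Real.exp (c * |x|)) μ)
    (hmean : ∫ x, x ∂μ = 0) (hvar : ∫ x, x ^ 2 ∂μ = 1) :
    ∃ η K : ℝ, 0 < η ∧ η ≤ c ∧ 0 < K ∧ ∀ (n : ℕ) (h : ℝ), 1 ≤ n → 1 ≤ h → h ^ 3 ≤ η * √n →
      Integrable (ratioIntegrand μ n h) →
      ‖(∫ t, ratioIntegrand μ n h t) -
        (√(2 * Real.pi) * ((∫ x, x ^ 3 ∂μ) * h ^ 3 / (24 * √n)) : ℝ)‖ ≤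
        K * (h ^ 2 / √n + h ^ 6 / n) := by
  obtain ⟨r, C, hr, hrc, hC, hR⟩ := exists_norm_mgfRatio_sub_le μ hc hexp hmean hvar
  set γ := ∫ x, x ^ 3 ∂μ
  set δ := min (1 / (16 * C)) (r / 2) with hδ_def
  have hδ : 0 < δ := by positivity
  set η := min (min 1 (1 / (4 * C))) (r / 2) with hη_def
  have hη : 0 < η := by positivity
  have hη1 : η ≤ 1 := (min_le_left _ _).trans (min_le_left _ _)
  have hηC : 4 * C * η ≤ 1 := by
    have : η ≤ 1 / (4 * C) := (min_le_left _ _).trans (min_le_right _ _)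
    rwa [le_div_iff₀' (by positivity)] at this
  have hηr : η ≤ r / 2 := min_le_right _ _
  have hδC : 16 * C * δ ≤ 1 := by
    have : δ ≤ 1 / (16 * C) := min_le_left _ _
    rwa [le_div_iff₀' (by positivity)] at this
  have hδr : δ ≤ r / 2 := min_le_right _ _
  set K₁ := 3 * C ^ 2 + C + |γ| with hK₁
  set K₂ := 4 + |γ| with hK₂
  set A := ∫ t : ℝ, (1 + |t|) ^ 6 * Real.exp (-(t ^ 2 / 4)) with hA
  have hA0 : 0 ≤ A := integral_nonneg fun t => by positivity
  refine ⟨η, K₁ * A + K₂ * (2 * Real.pi / δ), hη, by linarith, by positivity,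
    fun n h hn hh hh3 hint => ?_⟩
  have hv : 0 < √(n : ℝ) := Real.sqrt_pos.mpr (by exact_mod_cast hn)
  have hv2 : √(n : ℝ) ^ 2 = n := Real.sq_sqrt (by positivity)
  set v := √(n : ℝ) with hv_def
  have hn0 : (0 : ℝ) < n := by exact_mod_cast hn
  have hh0 : 0 < h := by linarith
  have hhη : h ≤ η * v := (le_self_pow₀ hh (by norm_num)).trans hh3
  have hh3' : h ^ 3 ≤ v := hh3.trans (mul_le_of_le_one_left hv.le hη1)
  have hh4 : 4 * C * h ^ 3 ≤ v := by
    calc 4 * C * h ^ 3 ≤ 4 * C * (η * v) := by gcongr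
      _ = (4 * C * η) * v := by ring
      _ ≤ v := mul_le_of_le_one_left hv.le hηC
  have hball : ∀ t : ℝ, |t| ≤ δ * v → ‖((h + Complex.I * t) / v : ℂ)‖ ≤ r := by
    intro t ht
    rw [norm_div, Complex.norm_real, Real.norm_of_nonneg hv.le, div_le_iff₀ hv]
    refine (norm_add_le _ _).trans ?_
    rw [norm_mul, Complex.norm_I, Complex.norm_real, Complex.norm_real, Real.norm_eq_abs,
      Real.norm_eq_abs, abs_of_pos hh0, one_mul]
    nlinarith
  have hpt : ∀ t : ℝ,
      ‖ratioIntegrand μ n h t - Complex.exp (-(t ^ 2 / 2 : ℝ)) * (γ * h ^ 3 / (24 * v) : ℝ)‖ ≤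
      K₁ * (h ^ 2 / v + h ^ 6 / n) * ((1 + |t|) ^ 6 * Real.exp (-(t ^ 2 / 4))) +
      K₂ * (h ^ 2 * (2 / (δ ^ 2 * n))) * (1 + (t / (δ * v)) ^ 2)⁻¹ := by
    intro t
    rcases le_or_gt |t| (δ * v) with ht | ht
    · obtain ⟨hR1, hR2⟩ := hR _ (hball t ht)
      have ht' : 16 * C * |t| ≤ v := by
        calc 16 * C * |t| ≤ 16 * C * (δ * v) := by gcongr
          _ = (16 * C * δ) * v := by ring
          _ ≤ v := mul_le_of_le_one_left hv.le hδC
      refine (norm_ratioIntegrand_sub_le_of_near hC hn hh hh4 ht' hR1 hR2).trans ?_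
      exact le_add_of_nonneg_right (by positivity)
    · have hR2 := (hR _ (hball 0 (by simp; positivity))).2
      simp only [Complex.ofReal_zero, mul_zero, add_zero] at hR2
      refine (norm_ratioIntegrand_sub_le_of_far hC hδ hn hh hh3' hh4 ht hR2).trans ?_
      exact le_add_of_nonneg_left (by positivity)
  have hmain : ∫ t : ℝ, Complex.exp (-(t ^ 2 / 2 : ℝ)) * (γ * h ^ 3 / (24 * v) : ℝ) =
      (√(2 * Real.pi) * (γ * h ^ 3 / (24 * v)) : ℝ) := by
    rw [integral_mul_const, integral_cexp_neg_sq_div_two, ← Complex.ofReal_mul]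
  rw [← hmain, ← integral_sub hint (integrable_cexp_neg_sq_div_two.mul_const _)]
  have hI1 := integrable_one_add_abs_pow_mul_exp.const_mul (K₁ * (h ^ 2 / v + h ^ 6 / n))
  have hI2 := (integrable_inv_one_add_sq.comp_div (by positivity : δ * v ≠ 0)).const_mul
    (K₂ * (h ^ 2 * (2 / (δ ^ 2 * n))))
  refine (norm_integral_le_of_norm_le (hI1.add hI2) (ae_of_all _ hpt)).trans ?_
  rw [integral_add' hI1 hI2, integral_const_mul, integral_const_mul,
    Measure.integral_comp_div (fun t : ℝ => (1 + t ^ 2)⁻¹), integral_univ_inv_one_add_sq,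
    abs_of_pos (by positivity), smul_eq_mul, ← hA]
  calc _ = K₁ * A * (h ^ 2 / v + h ^ 6 / n) + K₂ * (2 * Real.pi / δ) * (h ^ 2 / v) := by
        rw [← hv2]
        field_simp
    _ ≤ K₁ * A * (h ^ 2 / v + h ^ 6 / n) +
        K₂ * (2 * Real.pi / δ) * (h ^ 2 / v + h ^ 6 / n) := by
        gcongr
        exact le_add_of_nonneg_right (by positivity)
    _ = _ := by ring

/-- First-order Edgeworth expansion, at moderate-deviation level `h`, for the expectation of the
ramp function under the law `ν` of a normalized sum of `n` independent variables with law `μ`. -/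
theorem exists_abs_ramp_expansion_le (μ : Measure ℝ) [IsProbabilityMeasure μ] {c : ℝ}
    (hc : 0 < c) (hexp : Integrable (fun x => Real.exp (c * |x|)) μ)
    (hmean : ∫ x, x ∂μ = 0) (hvar : ∫ x, x ^ 2 ∂μ = 1) :
    ∃ η K : ℝ, 0 < η ∧ 0 < K ∧ ∀ (n : ℕ) (h : ℝ) (ν : Measure ℝ), IsProbabilityMeasure ν →
      (∀ z : ℂ, complexMGF id ν z = complexMGF id μ (z / √n) ^ n) →
      (∀ b : ℝ, |b| ≤ c * √n → Integrable (fun x => Real.exp (b * x)) ν) →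
      1 ≤ n → 1 ≤ h → h ^ 3 ≤ η * √n →
      |h * Real.exp (h ^ 2 / 2) * (∫ w, ramp (h * (w - h)) ∂ν -
          ∫ w, ramp (h * (w - h)) ∂(gaussianReal 0 1)) -
        (∫ x, x ^ 3 ∂μ) * h ^ 3 / (24 * √(2 * Real.pi) * √n)| ≤
        K * (h ^ 2 / √n + h ^ 6 / n) := by
  obtain ⟨η, K, hη, hηc, hK, hmain⟩ :=
    exists_norm_integral_ratioIntegrand_sub_le μ hc hexp hmean hvar
  refine ⟨η, K, hη, hK, fun n h ν _ hν hνexp hn hh hh3 => ?_⟩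
  have hh0 : 0 < h := by linarith
  have hv : 0 < √(n : ℝ) := Real.sqrt_pos.mpr (by exact_mod_cast hn)
  have hv2 : √(n : ℝ) ^ 2 = n := Real.sq_sqrt (by positivity)
  have hνh : Integrable (fun x => Real.exp (h * x)) ν := by
    apply hνexp
    rw [abs_of_pos hh0]
    calc h ≤ h ^ 3 := le_self_pow₀ hh (by norm_num)
      _ ≤ η * √n := hh3
      _ ≤ c * √n := by gcongr
  have hGh : Integrable (fun x => Real.exp (h * x)) (gaussianReal 0 1) :=
    integrable_exp_mul_gaussianReal h
  obtain ⟨hi1, he1⟩ := integral_ramp_eq_integral_complexMGF ν hh0 hνh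
  obtain ⟨hi2, he2⟩ := integral_ramp_eq_integral_complexMGF (gaussianReal 0 1) hh0 hGh
  have hpt : ∀ t : ℝ, ratioIntegrand μ n h t = Complex.exp (h ^ 2 / 2 : ℝ) *
      (rampKernel (t / h) * (Complex.exp (-(h + Complex.I * t) * h) *
        complexMGF id ν (h + Complex.I * t)) -
      rampKernel (t / h) * (Complex.exp (-(h + Complex.I * t) * h) *
        complexMGF id (gaussianReal 0 1) (h + Complex.I * t))) := by
    intro t
    rw [hν, complexMGF_id_gaussianReal, ratioIntegrand, mgfRatio, mul_pow, ← Complex.exp_nat_mul]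
    set ζ : ℂ := h + Complex.I * t with hζ
    have hnC : (n : ℂ) = (√(n : ℝ) : ℂ) ^ 2 := by exact_mod_cast hv2.symm
    have hvC : (√(n : ℝ) : ℂ) ≠ 0 := by exact_mod_cast hv.ne'
    have a1 : Complex.exp (n * -((ζ / √n) ^ 2 / 2)) = Complex.exp (-(ζ ^ 2 / 2)) := by
      congr 1
      rw [hnC]
      field_simp
    have hsq : ζ ^ 2 = h ^ 2 - t ^ 2 + 2 * h * Complex.I * t := by
      rw [hζ, add_sq, mul_pow, Complex.I_sq]
      ring
    have a2 : Complex.exp (-(t ^ 2 / 2 : ℝ)) * Complex.exp (-(ζ ^ 2 / 2)) =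
        Complex.exp (h ^ 2 / 2 : ℝ) * Complex.exp (-ζ * h) := by
      rw [← Complex.exp_add, ← Complex.exp_add, hsq, hζ]
      congr 1
      push_cast
      ring
    have a3 : Complex.exp (-(t ^ 2 / 2 : ℝ)) =
        Complex.exp (h ^ 2 / 2 : ℝ) * (Complex.exp (-ζ * h) *
          Complex.exp (ζ * (0 : ℝ) + (1 : NNReal) * ζ ^ 2 / 2)) := by
      rw [← Complex.exp_add, ← Complex.exp_add, hsq, hζ]
      congr 1
      push_cast
      ring
    rw [a1]
    calc _ = rampKernel (t / h) * ((Complex.exp (-(t ^ 2 / 2 : ℝ)) *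
          Complex.exp (-(ζ ^ 2 / 2))) * complexMGF id μ (ζ / √n) ^ n -
          Complex.exp (-(t ^ 2 / 2 : ℝ))) := by ring
      _ = _ := by rw [a2, a3]; ring
  have hint : Integrable (ratioIntegrand μ n h) := by
    rw [show ratioIntegrand μ n h = _ from funext hpt]
    exact (hi1.sub hi2).const_mul _
  have hval : ((h * Real.exp (h ^ 2 / 2) * (∫ w, ramp (h * (w - h)) ∂ν -
      ∫ w, ramp (h * (w - h)) ∂(gaussianReal 0 1)) : ℝ) : ℂ) =
      (2 * Real.pi : ℂ)⁻¹ * ∫ t, ratioIntegrand μ n h t := by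
    rw [show ratioIntegrand μ n h = _ from funext hpt, integral_const_mul, integral_sub hi1 hi2]
    push_cast
    rw [he1, he2]
    have : (h : ℂ) ≠ 0 := by exact_mod_cast hh0.ne'
    field_simp
  have hm := hmain n h hn hh hh3 hint
  have hpi : 1 ≤ 2 * Real.pi := by linarith [Real.pi_gt_three]
  have hs2 : √(2 * Real.pi) ^ 2 = 2 * Real.pi := Real.sq_sqrt (by positivity)
  have hs : 0 < √(2 * Real.pi) := Real.sqrt_pos.mpr (by positivity)
  have hsinv : (2 * Real.pi)⁻¹ * √(2 * Real.pi) = (√(2 * Real.pi))⁻¹ := by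
    calc _ = (√(2 * Real.pi) ^ 2)⁻¹ * √(2 * Real.pi) := by rw [hs2]
      _ = _ := by field_simp
  rw [← Real.norm_eq_abs, ← Complex.norm_real, Complex.ofReal_sub, hval]
  calc _ = ‖(2 * Real.pi : ℂ)⁻¹ * ((∫ t, ratioIntegrand μ n h t) -
        (√(2 * Real.pi) * ((∫ x, x ^ 3 ∂μ) * h ^ 3 / (24 * √n)) : ℝ))‖ := by
        rw [mul_sub]
        congr 2
        rw [show ((2 * Real.pi : ℂ)⁻¹) = ((2 * Real.pi)⁻¹ : ℝ) by push_cast; rfl,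
          ← Complex.ofReal_mul]
        congr 1
        rw [← mul_assoc, hsinv]
        field_simp
    _ = (2 * Real.pi)⁻¹ * ‖(∫ t, ratioIntegrand μ n h t) -
        (√(2 * Real.pi) * ((∫ x, x ^ 3 ∂μ) * h ^ 3 / (24 * √n)) : ℝ)‖ := by
        rw [norm_mul, show ((2 * Real.pi : ℂ)⁻¹) = ((2 * Real.pi)⁻¹ : ℝ) by push_cast; rfl,
          Complex.norm_real, Real.norm_of_nonneg (by positivity)]
    _ ≤ 1 * (K * (h ^ 2 / √n + h ^ 6 / n)) := by
        gcongr
        exact inv_le_one_of_one_le₀ hpi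
    _ = _ := one_mul _

/-- The columns of an independent array are independent. -/
lemma iIndepFun_columns {Ω : Type*} [MeasurableSpace Ω] {P : Measure Ω}
    [IsProbabilityMeasure P] {X : ℕ → ℕ → Ω → ℝ} (hX : ∀ i j, Measurable (X i j))
    (hindep : iIndepFun (fun p : ℕ × ℕ => X p.1 p.2) P) :
    iIndepFun (fun j ω i => X i j ω) P := by
  have hinj : Function.Injective (fun q : (_ : ℕ) × ℕ => ((q.2, q.1) : ℕ × ℕ)) := by
    rintro ⟨a, b⟩ ⟨a', b'⟩ h
    simp only [Prod.mk.injEq] at h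
    simp [h.1, h.2]
  have h1 : iIndepFun (fun (q : (_ : ℕ) × ℕ) ω => X q.2 q.1 ω) P := hindep.precomp hinj
  have : ∀ i j, IsProbabilityMeasure (P.map (X i j)) :=
    fun i j => Measure.isProbabilityMeasure_map (hX i j).aemeasurable
  have hcol : ∀ j, P.map (fun ω i => X i j ω) = Measure.infinitePi fun i => P.map (X i j) := by
    intro j
    refine iIndepFun.map_fun_eq_infinitePi_map (fun i => hX i j) ?_
    exact hindep.precomp (g := fun i => (i, j)) fun a b h => by simpa using h
  have hcurry : (MeasurableEquiv.piCurry fun _ _ : ℕ => ℝ) ∘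
      (fun ω (q : (_ : ℕ) × ℕ) => X q.2 q.1 ω) = fun ω j i => X i j ω := by
    ext; simp [Sigma.curry]
  rw [iIndepFun_iff_map_fun_eq_infinitePi_map (by fun_prop)]
  simp_rw [hcol]
  rw [← Measure.infinitePi_map_piCurry (fun j i => P.map (X i j)),
    ← iIndepFun.map_fun_eq_infinitePi_map (X := fun (q : (_ : ℕ) × ℕ) ω => X q.2 q.1 ω)
      (by fun_prop) h1, Measure.map_map (by fun_prop) (by fun_prop), hcurry]

section NormalizedSum

variable {Ω : Type*} [MeasurableSpace Ω] {P : Measure Ω} {X : ℕ → ℕ → Ω → ℝ}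

/-- The law of one coordinate of the normalized sum. -/
noncomputable def sumLaw (P : Measure Ω) (X : ℕ → ℕ → Ω → ℝ) (n : ℕ) : Measure ℝ :=
  P.map fun ω => (√(n : ℝ))⁻¹ * ∑ i ∈ Finset.range n, X i 0 ω

lemma isProbabilityMeasure_sumLaw [IsProbabilityMeasure P]
    (hX : ∀ i j, Measurable (X i j)) (n : ℕ) :
    IsProbabilityMeasure (sumLaw P X n) :=
  Measure.isProbabilityMeasure_map (Measurable.aemeasurable (by fun_prop))

lemma map_normalizedSum_column [IsProbabilityMeasure P]
    (hX : ∀ i j, Measurable (X i j))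
    (hindep : iIndepFun (fun p : ℕ × ℕ => X p.1 p.2) P)
    (hident : ∀ i j, IdentDistrib (X i j) (X 0 0) P P) (n j : ℕ) :
    P.map (fun ω => (√(n : ℝ))⁻¹ * ∑ i ∈ Finset.range n, X i j ω) = sumLaw P X n := by
  have hcol : ∀ k, iIndepFun (fun i => X i k) P := fun k =>
    hindep.precomp (g := fun i => (i, k)) fun a b h => by simpa using h
  have h1 : ∀ k, IsProbabilityMeasure
      (P.map (fun ω => (√(n : ℝ))⁻¹ * ∑ i ∈ Finset.range n, X i k ω)) := fun k =>
    Measure.isProbabilityMeasure_map (Measurable.aemeasurable (by fun_prop))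
  have := h1 j
  have := isProbabilityMeasure_sumLaw (P := P) hX n
  refine Measure.ext_of_charFun (funext fun t => ?_)
  rw [sumLaw, charFun_inv_sqrt_mul_sum (X := fun i => X i j) (hcol j) fun i =>
      (hident i j).trans (hident 0 j).symm,
    charFun_inv_sqrt_mul_sum (X := fun i => X i 0) (hcol 0) fun i =>
      (hident i 0).trans (hident 0 0).symm,
    (hident 0 j).map_eq]

lemma complexMGF_sumLaw (hX : ∀ i j, Measurable (X i j))
    (hindep : iIndepFun (fun p : ℕ × ℕ => X p.1 p.2) P)
    (hident : ∀ i j, IdentDistrib (X i j) (X 0 0) P P) (n : ℕ) (z : ℂ) :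
    complexMGF id (sumLaw P X n) z = complexMGF id (P.map (X 0 0)) (z / √n) ^ n := by
  rw [sumLaw, complexMGF_id_map (Measurable.aemeasurable (by fun_prop)),
    complexMGF_id_map (hX 0 0).aemeasurable]
  have hrow : iIndepFun (fun i : Fin n => X i 0) P :=
    hindep.precomp (g := fun i : Fin n => ((i : ℕ), 0)) fun a b h => by
      simpa [Fin.ext_iff] using h
  have h1 := hrow.integral_fun_prod_comp (f := fun _ (x : ℝ) => Complex.exp (z / √n * x))
    (fun i => (hX i 0).aemeasurable) (fun i => by fun_prop)
  have h2 : ∀ i : Fin n, ∫ ω, Complex.exp (z / √n * X i 0 ω) ∂P =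
      complexMGF (X 0 0) P (z / √n) := fun i => by
    rw [← complexMGF_congr_identDistrib (hident i 0)]
    rfl
  simp only [h2, Finset.prod_const, Finset.card_univ, Fintype.card_fin] at h1
  rw [← h1, complexMGF]
  congr 1
  ext ω
  rw [← Complex.exp_sum, ← Finset.sum_range fun i => z / √n * (X i 0 ω : ℂ)]
  congr 1
  push_cast
  rw [← Finset.mul_sum]
  ring

lemma integrable_exp_mul_sumLaw [IsProbabilityMeasure P]
    (hX : ∀ i j, Measurable (X i j))
    (hindep : iIndepFun (fun p : ℕ × ℕ => X p.1 p.2) P)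
    (hident : ∀ i j, IdentDistrib (X i j) (X 0 0) P P) {c : ℝ}
    (hexp : Integrable (fun x => Real.exp (c * |x|)) (P.map (X 0 0))) {n : ℕ} (hn : 1 ≤ n)
    {b : ℝ} (hb : |b| ≤ c * √n) :
    Integrable (fun x => Real.exp (b * x)) (sumLaw P X n) := by
  have hv : 0 < √(n : ℝ) := Real.sqrt_pos.mpr (by exact_mod_cast hn)
  have hb' : |b / √n| ≤ c := by
    rwa [abs_div, abs_of_pos hv, div_le_iff₀ hv]
  have h0 := integrable_exp_mul_of_integrable_exp_mul_abs hexp hb'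
  have hcol : iIndepFun (fun i => X i 0) P :=
    hindep.precomp (g := fun i => (i, 0)) fun a b h => by simpa using h
  have h1 : ∀ i, Integrable (fun ω => Real.exp (b / √n * X i 0 ω)) P := by
    intro i
    rw [← (hident i 0).map_eq] at h0
    exact h0.comp_measurable (hX i 0)
  have h2 := hcol.integrable_exp_mul_sum (fun i => hX i 0) (s := Finset.range n)
    (t := b / √n) fun i _ => h1 i
  rw [sumLaw, integrable_map_measure (by fun_prop) (Measurable.aemeasurable (by fun_prop))]
  refine h2.congr (ae_of_all _ fun ω => ?_)
  simp only [Finset.sum_apply, Function.comp_apply]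
  congr 1
  field_simp

end NormalizedSum

section MaxCoord

lemma maxCoord_le_iff {d : ℕ} (hd : 0 < d) (w : EuclideanSpace ℝ (Fin d)) (x : ℝ) :
    maxCoord w ≤ x ↔ ∀ j, w j ≤ x := by
  have : Nonempty (Fin d) := ⟨⟨0, hd⟩⟩
  exact ciSup_le_iff (Set.finite_range _).bddAbove

lemma measureReal_maxCoord_le_of_iIndepFun {Ω : Type*} [MeasurableSpace Ω] {P : Measure Ω}
    {d : ℕ} (hd : 0 < d) {W : Ω → EuclideanSpace ℝ (Fin d)} {ν : Measure ℝ}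
    (hmeas : ∀ j, Measurable fun ω => W ω j) (hindep : iIndepFun (fun j ω => W ω j) P)
    (hlaw : ∀ j, P.map (fun ω => W ω j) = ν) (x : ℝ) :
    P.real {ω | maxCoord (W ω) ≤ x} = ν.real (Set.Iic x) ^ d := by
  have hset : {ω | maxCoord (W ω) ≤ x} = ⋂ j, (fun ω => W ω j) ⁻¹' Set.Iic x := by
    ext ω
    simp [maxCoord_le_iff hd]
  rw [hset, measureReal_def,
    hindep.meas_iInter fun j => ⟨Set.Iic x, measurableSet_Iic, rfl⟩]
  have : ∀ j, P ((fun ω => W ω j) ⁻¹' Set.Iic x) = ν (Set.Iic x) := fun j => by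
    rw [← Measure.map_apply (hmeas j) measurableSet_Iic, hlaw]
  simp [this, measureReal_def, ENNReal.toReal_pow]

lemma measureReal_maxCoord_normalizedSum_le {Ω : Type*} [MeasurableSpace Ω] {P : Measure Ω}
    [IsProbabilityMeasure P] {X : ℕ → ℕ → Ω → ℝ} (hX : ∀ i j, Measurable (X i j))
    (hindep : iIndepFun (fun p : ℕ × ℕ => X p.1 p.2) P)
    (hident : ∀ i j, IdentDistrib (X i j) (X 0 0) P P) (n : ℕ) {d : ℕ} (hd : 0 < d) (x : ℝ) :
    P.real {ω | maxCoord (normalizedSum X n d ω) ≤ x} = (sumLaw P X n).real (Set.Iic x) ^ d := by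
  refine measureReal_maxCoord_le_of_iIndepFun hd (fun j => ?_) ?_ (fun j => ?_) x
  · simp only [normalizedSum]
    fun_prop
  · have h1 := (iIndepFun_columns hX hindep).precomp (g := fun j : Fin d => (j : ℕ))
      Fin.val_injective
    exact h1.comp (fun _ v => (√(n : ℝ))⁻¹ * ∑ i ∈ Finset.range n, v i) fun _ => by fun_prop
  · exact map_normalizedSum_column hX hindep hident n j

lemma measureReal_maxCoord_gaussian_le {Ω : Type*} [MeasurableSpace Ω] {P : Measure Ω}
    {d : ℕ} (hd : 0 < d) {Z : Ω → EuclideanSpace ℝ (Fin d)}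
    (hZ : HasLaw Z (multivariateGaussian 0 1) P) (x : ℝ) :
    P.real {ω | maxCoord (Z ω) ≤ x} = (gaussianReal 0 1).real (Set.Iic x) ^ d := by
  have hset : MeasurableSet {w : EuclideanSpace ℝ (Fin d) | maxCoord w ≤ x} := by
    simp_rw [maxCoord_le_iff hd, Set.ofPred_forall]
    exact MeasurableSet.iInter fun j => measurableSet_le (by fun_prop) (by fun_prop)
  rw [measureReal_def, hZ.measure_eq hset, multivariateGaussian_zero_one, ← map_pi_eq_stdGaussian,
    Measure.map_apply (by fun_prop) hset]
  have hpre : WithLp.toLp 2 ⁻¹' {w : EuclideanSpace ℝ (Fin d) | maxCoord w ≤ x} =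
      Set.univ.pi fun _ : Fin d => Set.Iic x := by
    ext w
    simp [maxCoord_le_iff hd, Pi.le_def]
  rw [hpre, Measure.pi_pi]
  simp [measureReal_def, ENNReal.toReal_pow]

end MaxCoord

lemma abs_sub_mul_le_two_mul_abs_pow_sub {F G : ℝ} {d : ℕ} (hF0 : 0 ≤ F) (hF1 : F ≤ 1)
    (hG0 : 0 ≤ G) (hF : 1 / 2 ≤ F ^ d) (hG : 1 / 2 ≤ G ^ d) :
    |F - G| * d ≤ 2 * |F ^ d - G ^ d| := by
  set m := min F G with hm
  have hm0 : 0 ≤ m := le_min hF0 hG0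
  have hmd : 1 / 2 ≤ m ^ d := by
    rcases min_choice F G with h | h <;> rw [hm, h] <;> assumption
  have hm1 : m ≤ 1 := (min_le_left _ _).trans hF1
  have hsum : (d : ℝ) * (1 / 2) ≤ ∑ i ∈ Finset.range d, F ^ i * G ^ (d - 1 - i) := by
    calc (d : ℝ) * (1 / 2) = ∑ i ∈ Finset.range d, (1 / 2 : ℝ) := by simp
      _ ≤ _ := by
        refine Finset.sum_le_sum fun i hi => ?_
        have hi' : i < d := Finset.mem_range.mp hi
        calc (1 / 2 : ℝ) ≤ m ^ d := hmd
          _ ≤ m ^ (d - 1) := pow_le_pow_of_le_one hm0 hm1 (Nat.sub_le _ _)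
          _ = m ^ i * m ^ (d - 1 - i) := by rw [← pow_add]; congr 1; omega
          _ ≤ F ^ i * G ^ (d - 1 - i) := by
            gcongr
            · exact min_le_left _ _
            · exact min_le_right _ _
  have h := congrArg abs (geom_sum₂_mul F G d)
  rw [abs_mul, abs_of_nonneg (by linarith [(by positivity : (0 : ℝ) ≤ d * (1 / 2))])] at h
  rw [← h]
  have := mul_le_mul_of_nonneg_right hsum (abs_nonneg (F - G))
  linarith

lemma measureReal_Ioi_eq (μ : Measure ℝ) [IsProbabilityMeasure μ] (x : ℝ) :
    μ.real (Set.Ioi x) = 1 - μ.real (Set.Iic x) := by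
  rw [← Set.compl_Iic, probReal_compl_eq_one_sub measurableSet_Iic]

/-- If the `d`-th powers of two distribution functions, one of them Gaussian, are close, then so
are the corresponding expectations of the ramp function at the level `h` with `h e^{h²/2} = d`. -/
lemma mul_abs_integral_ramp_sub_le (ν : Measure ℝ) [IsProbabilityMeasure ν] {d : ℕ} {h D : ℝ}
    (hh : 0 < h) (hhd : h * Real.exp (h ^ 2 / 2) = d) (hD : D ≤ 1 / 10)
    (hdist : ∀ x, |ν.real (Set.Iic x) ^ d - (gaussianReal 0 1).real (Set.Iic x) ^ d| ≤ D) :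
    d * |∫ w, ramp (h * (w - h)) ∂ν - ∫ w, ramp (h * (w - h)) ∂(gaussianReal 0 1)| ≤ 4 * D := by
  have hd0 : (0 : ℝ) < d := by rw [← hhd]; positivity
  have hs : (5 / 2 : ℝ) ≤ √(2 * Real.pi) := by
    rw [Real.le_sqrt' (by norm_num)]
    have := Real.pi_gt_d2
    norm_num at this ⊢
    linarith
  have hG : 6 / 10 ≤ (gaussianReal 0 1).real (Set.Iic h) ^ d := by
    have h1 := gaussianReal_Ioi_le hh
    rw [hhd, measureReal_Ioi_eq, mul_inv] at h1
    set p := (gaussianReal 0 1).real (Set.Iic h)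
    have hp0 : 0 ≤ p := measureReal_nonneg
    have h2 := one_add_mul_le_pow (a := p - 1) (by linarith) d
    rw [add_sub_cancel] at h2
    have h3 : (d : ℝ) * (1 - p) ≤ 2 / 5 := by
      calc (d : ℝ) * (1 - p) ≤ d * ((d : ℝ)⁻¹ * (√(2 * Real.pi))⁻¹) := by gcongr
        _ = (√(2 * Real.pi))⁻¹ := by field_simp
        _ ≤ (5 / 2 : ℝ)⁻¹ := by gcongr
        _ = 2 / 5 := by norm_num
    linarith
  have hF : 1 / 2 ≤ ν.real (Set.Iic h) ^ d := by
    have := abs_le.mp (hdist h)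
    linarith
  have hmono : ∀ (ρ : Measure ℝ) [IsProbabilityMeasure ρ] (x : ℝ), h ≤ x →
      ρ.real (Set.Iic h) ^ d ≤ ρ.real (Set.Iic x) ^ d := by
    intro ρ _ x hx
    exact pow_le_pow_left₀ measureReal_nonneg (measureReal_mono (Set.Iic_subset_Iic.mpr hx)) d
  have htail : ∀ x, h ≤ x →
      |ν.real (Set.Ioi x) - (gaussianReal 0 1).real (Set.Ioi x)| ≤ 2 * D / d := by
    intro x hx
    rw [measureReal_Ioi_eq, measureReal_Ioi_eq, sub_sub_sub_cancel_left, abs_sub_comm,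
      le_div_iff₀ hd0]
    refine (abs_sub_mul_le_two_mul_abs_pow_sub measureReal_nonneg measureReal_le_one
      measureReal_nonneg (hF.trans (hmono ν x hx))
      ((by linarith : (1 / 2 : ℝ) ≤ _).trans (hmono (gaussianReal 0 1) x hx))).trans ?_
    linarith [hdist x]
  have := abs_integral_ramp_sub_le ν (gaussianReal 0 1) hh htail
  calc _ ≤ d * (2 * (2 * D / d)) := by gcongr
    _ = 4 * D := by field_simp; ring

lemma exists_mul_exp_eq {d : ℕ} (hd : 3 ≤ d) :
    ∃ h : ℝ, 1 ≤ h ∧ h * Real.exp (h ^ 2 / 2) = d ∧ Real.log d ≤ h ^ 2 ∧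
      h ^ 2 ≤ 2 * Real.log d := by
  have hd' : (3 : ℝ) ≤ d := by exact_mod_cast hd
  have hcont : ContinuousOn (fun h : ℝ => h * Real.exp (h ^ 2 / 2)) (Set.Icc 1 d) := by fun_prop
  obtain ⟨h, ⟨h1, -⟩, hh⟩ := intermediate_value_Icc (by linarith : (1 : ℝ) ≤ d) hcont
    (show (d : ℝ) ∈ Set.Icc _ _ by
      constructor
      · have : Real.exp (1 ^ 2 / 2) ≤ Real.exp 1 := Real.exp_le_exp.mpr (by norm_num)
        simp only [one_mul]
        linarith [Real.exp_one_lt_d9]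
      · exact le_mul_of_one_le_right (by linarith) (Real.one_le_exp (by positivity)))
  have hh0 : 0 < h := by linarith
  have hlog : Real.log d = Real.log h + h ^ 2 / 2 := by
    rw [← hh]
    simp only
    rw [Real.log_mul hh0.ne' (Real.exp_pos _).ne', Real.log_exp]
  refine ⟨h, h1, hh, ?_, ?_⟩
  · nlinarith [Real.log_le_sub_one_of_pos hh0, sq_nonneg (h - 1)]
  · linarith [Real.log_nonneg h1]

lemma abs_sub_le_kolmogorovDist {Ω Ω' : Type*} [MeasurableSpace Ω] [MeasurableSpace Ω']
    (P : Measure Ω) (P' : Measure Ω') [IsProbabilityMeasure P] [IsProbabilityMeasure P']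
    (U : Ω → ℝ) (V : Ω' → ℝ) (x : ℝ) :
    |P.real {ω | U ω ≤ x} - P'.real {ω | V ω ≤ x}| ≤ kolmogorovDist P P' U V := by
  refine le_ciSup (f := fun x => |P.real {ω | U ω ≤ x} - P'.real {ω | V ω ≤ x}|) ⟨1, ?_⟩ x
  rintro _ ⟨y, rfl⟩
  have h1 : P.real {ω | U ω ≤ y} ≤ 1 := measureReal_le_one
  have h2 : P'.real {ω | V ω ≤ y} ≤ 1 := measureReal_le_one
  have h3 : 0 ≤ P.real {ω | U ω ≤ y} := measureReal_nonneg
  have h4 : 0 ≤ P'.real {ω | V ω ≤ y} := measureReal_nonneg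
  exact abs_le.mpr ⟨by linarith, by linarith⟩

lemma tendsto_log_atTop_of_tendsto {d : ℕ → ℕ}
    (hd_upper : Tendsto (fun n : ℕ => Real.log (d n) ^ 3 / (n : ℝ)) atTop (𝓝 0))
    (hd_lower : Tendsto (fun n : ℕ => (d n : ℝ) * Real.log (d n) ^ 3 / (n : ℝ)) atTop atTop) :
    Tendsto (fun n => Real.log (d n)) atTop atTop := by
  refine Real.tendsto_log_atTop.comp (tendsto_atTop_mono' _ ?_ hd_lower)
  filter_upwards [hd_upper.eventually_le_const one_pos] with n hn
  rw [mul_div_assoc]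
  exact mul_le_of_le_one_right (Nat.cast_nonneg _) hn

/-- The lower bound obtained from the moderate deviation expansion once its error terms are
negligible. -/
lemma le_of_expansion {g K D q h L : ℝ} (hg : 0 < g) (hh : 0 < h)
    (hL : L ≤ q) (hL0 : 0 ≤ L) (h1 : 4 * K / g ≤ h) (h2 : K * q ≤ g / 4)
    (hmain : g * q ≤ 4 * D + K * (q / h + q ^ 2)) : g / 8 * L ≤ D := by
  have hq : 0 ≤ q := hL0.trans hL
  have e1 : K * (q / h) ≤ g / 4 * q := by
    rw [div_le_iff₀ hg] at h1
    rw [← mul_div_assoc, div_le_iff₀ hh]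
    nlinarith
  have e2 : K * q ^ 2 ≤ g / 4 * q := by nlinarith
  nlinarith

theorem proposition1
    {Ω : Type*} [MeasurableSpace Ω] (P : Measure Ω) [IsProbabilityMeasure P]
    -- the array `(X_{ij})` of i.i.d. random variables
    (X : ℕ → ℕ → Ω → ℝ)
    (hX_meas : ∀ i j, Measurable (X i j))
    (hX_indep : iIndepFun (fun p : ℕ × ℕ => X p.1 p.2) P)
    (hX_ident : ∀ i j, IdentDistrib (X i j) (X 0 0) P P)
    -- exponential moment, mean zero, unit variance, nonzero third moment
    (hX_exp : ∃ c : ℝ, 0 < c ∧ Integrable (fun ω => Real.exp (c * |X 0 0 ω|)) P)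
    (hX_mean : ∫ ω, X 0 0 ω ∂P = 0)
    (hX_var : ∫ ω, X 0 0 ω ^ 2 ∂P = 1)
    (hX_third : ∫ ω, X 0 0 ω ^ 3 ∂P ≠ 0)
    -- the dimension, as a function of the sample size
    (d : ℕ → ℕ) (hd : ∀ n, 3 ≤ d n)
    (hd_upper : Tendsto (fun n : ℕ => Real.log (d n) ^ 3 / (n : ℝ)) atTop (𝓝 0))
    (hd_lower : Tendsto (fun n : ℕ => (d n : ℝ) * Real.log (d n) ^ 3 / (n : ℝ)) atTop atTop)
    -- for each `n`, a Gaussian vector `Z ~ N(0, I_d)` on some probability space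
    {Ω' : ℕ → Type*} [∀ n, MeasurableSpace (Ω' n)] (P' : ∀ n, Measure (Ω' n))
    [∀ n, IsProbabilityMeasure (P' n)]
    (Z : ∀ n, Ω' n → EuclideanSpace ℝ (Fin (d n)))
    (hZ : ∀ n, HasLaw (Z n) (multivariateGaussian 0 1) (P' n)) :
    (0 : EReal) < limsup (fun n : ℕ =>
      ((√((n : ℝ) / Real.log (d n) ^ 3) *
        kolmogorovDist P (P' n)
          (fun ω => maxCoord (normalizedSum X n (d n) ω))
          (fun ω' => maxCoord (Z n ω')) : ℝ) : EReal)) atTop := by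
  obtain ⟨c, hc, hexp⟩ := hX_exp
  set μ := P.map (X 0 0) with hμ
  have hX0 := (hX_meas 0 0).aemeasurable (μ := P)
  have : IsProbabilityMeasure μ := Measure.isProbabilityMeasure_map hX0
  have hμexp : Integrable (fun x => Real.exp (c * |x|)) μ :=
    (integrable_map_measure (by fun_prop) hX0).mpr hexp
  have hμ1 : ∫ x, x ∂μ = 0 := by rw [hμ, integral_map hX0 (by fun_prop), hX_mean]
  have hμ2 : ∫ x, x ^ 2 ∂μ = 1 := by rw [hμ, integral_map hX0 (by fun_prop), hX_var]
  have hμ3 : ∫ x, x ^ 3 ∂μ ≠ 0 := by rwa [hμ, integral_map hX0 (by fun_prop)]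
  obtain ⟨η, K, hη, hK, hmain⟩ := exists_abs_ramp_expansion_le μ hc hμexp hμ1 hμ2
  set γ := ∫ x, x ^ 3 ∂μ
  set g := |γ| / (24 * √(2 * Real.pi)) with hg_def
  have hg : 0 < g := by positivity
  have hsqrt : Tendsto (fun n : ℕ => √(Real.log (d n) ^ 3 / (n : ℝ))) atTop (𝓝 0) := by
    simpa using hd_upper.sqrt
  have hlog := tendsto_log_atTop_of_tendsto hd_upper hd_lower
  set κ := min (g / 8) (1 / 10) with hκ_def
  have hκ : 0 < κ := by positivity
  refine lt_of_lt_of_le (EReal.coe_pos.mpr hκ)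
    (le_limsup_of_frequently_le' (Eventually.frequently ?_))
  filter_upwards [eventually_ge_atTop 1, hlog.eventually_ge_atTop ((4 * K / g) ^ 2),
    hsqrt.eventually_le_const one_pos,
    hsqrt.eventually_le_const (show 0 < η / 3 by positivity),
    hsqrt.eventually_le_const (show 0 < g / (12 * K) by positivity)] with n hn hℓ hL1 hLη hLK
  set ℓ := Real.log (d n) with hℓ_def
  set L := √(ℓ ^ 3 / (n : ℝ)) with hL_def
  set D := kolmogorovDist P (P' n) (fun ω => maxCoord (normalizedSum X n (d n) ω))
    (fun ω' => maxCoord (Z n ω')) with hD_def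
  have hdn := hd n
  have hd0 : 0 < d n := by omega
  have hn0 : (0 : ℝ) < n := by exact_mod_cast hn
  have hℓ0 : 0 < ℓ := Real.log_pos (by exact_mod_cast (by omega : 1 < d n))
  have hL0 : 0 < L := Real.sqrt_pos.mpr (by positivity)
  have hLinv : √((n : ℝ) / ℓ ^ 3) = L⁻¹ := by rw [hL_def, ← Real.sqrt_inv, inv_div]
  have hv : 0 < √(n : ℝ) := Real.sqrt_pos.mpr hn0
  have hv2 : √(n : ℝ) ^ 2 = n := Real.sq_sqrt hn0.le
  rw [EReal.coe_le_coe_iff, hLinv, inv_mul_eq_div, le_div_iff₀ hL0]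
  rcases lt_or_ge (1 / 10) D with hD | hD
  · calc κ * L ≤ 1 / 10 * 1 := by
          gcongr
          exact min_le_right _ _
      _ ≤ D := by linarith
  refine le_trans (mul_le_mul_of_nonneg_right (min_le_left _ _) hL0.le) ?_
  obtain ⟨h, hh1, hhd, hhl, hhu⟩ := exists_mul_exp_eq hdn
  have hh0 : 0 < h := by linarith
  set q := h ^ 3 / √(n : ℝ) with hq_def
  have hLq : L ≤ q := by
    rw [hL_def, Real.sqrt_le_left (by positivity), hq_def, div_pow, hv2]
    gcongr
    calc ℓ ^ 3 ≤ (h ^ 2) ^ 3 := by gcongr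
      _ = _ := by ring
  have hqL : q ≤ 3 * L := by
    have h1 : q ^ 2 ≤ (3 * L) ^ 2 := by
      rw [mul_pow, hL_def, Real.sq_sqrt (by positivity), hq_def, div_pow, hv2, ← mul_div_assoc]
      gcongr
      calc (h ^ 3) ^ 2 = (h ^ 2) ^ 3 := by ring
        _ ≤ (2 * ℓ) ^ 3 := by gcongr
        _ ≤ 3 ^ 2 * ℓ ^ 3 := by nlinarith [pow_pos hℓ0 3]
    exact (pow_le_pow_iff_left₀ (by positivity) (by positivity) two_ne_zero).mp h1
  have hprob := isProbabilityMeasure_sumLaw (P := P) hX_meas n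
  have hdist : ∀ x, |(sumLaw P X n).real (Set.Iic x) ^ d n -
      (gaussianReal 0 1).real (Set.Iic x) ^ d n| ≤ D := by
    intro x
    have := abs_sub_le_kolmogorovDist P (P' n) (fun ω => maxCoord (normalizedSum X n (d n) ω))
      (fun ω' => maxCoord (Z n ω')) x
    rwa [measureReal_maxCoord_normalizedSum_le hX_meas hX_indep hX_ident n hd0,
      measureReal_maxCoord_gaussian_le hd0 (hZ n)] at this
  have hupper := mul_abs_integral_ramp_sub_le (sumLaw P X n) hh0 hhd hD hdist
  have hlower := hmain n h (sumLaw P X n) hprob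
    (complexMGF_sumLaw hX_meas hX_indep hX_ident n)
    (fun b hb => integrable_exp_mul_sumLaw hX_meas hX_indep hX_ident hμexp hn hb) hn hh1
    (by
      rw [← div_le_iff₀ hv]
      linarith)
  rw [hhd] at hlower
  have hterm : |γ * h ^ 3 / (24 * √(2 * Real.pi) * √n)| = g * q := by
    rw [abs_div, abs_mul, abs_of_pos (by positivity : 0 < h ^ 3),
      abs_of_pos (by positivity : 0 < 24 * √(2 * Real.pi) * √n), hg_def, hq_def,
      div_mul_div_comm]
  refine le_of_expansion (q := q) (h := h) (K := K) hg hh0 hLq hL0.le ?_ ?_ ?_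
  · exact (pow_le_pow_iff_left₀ (by positivity) hh0.le two_ne_zero).mp (hℓ.trans hhl)
  · rw [le_div_iff₀ (by positivity)] at hLK
    have := mul_le_mul_of_nonneg_left hqL hK.le
    linarith
  · rw [← hterm]
    have e1 : h ^ 2 / √(n : ℝ) + h ^ 6 / n = q / h + q ^ 2 := by
      rw [hq_def, div_pow, hv2]
      field_simp
    rw [← e1]
    set E := ∫ w, ramp (h * (w - h)) ∂(sumLaw P X n) - ∫ w, ramp (h * (w - h)) ∂(gaussianReal 0 1)
    have e2 : |(d n : ℝ) * E| ≤ 4 * D := by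
      rwa [abs_mul, Nat.abs_cast]
    have e3 := abs_sub_abs_le_abs_sub (γ * h ^ 3 / (24 * √(2 * Real.pi) * √n)) ((d n : ℝ) * E)
    rw [abs_sub_comm] at e3
    linarith
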